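/- Let $Q$ be the connected graph with $7$ vertices $c, t, \ell_1, \dots, \ell_5$ and $8$ edges in which $c$ and $t$ are joined by three edges and $c$ is joined to each $\ell_i$ by one edge. The universal covering tree $T$ of $Q$ (a tree with a covering map to $Q$) exists. Every vertex of $T$ has degree $1$, $3$ or $8$; let $V_1, V_3, V_8$ be the sets of vertices of degree $1$, $3$, $8$ respectively. Let $X$ be the convex hull of $V_3$ in $T$. Then $X$ is a subtree with vertex set $V_3 \cup V_8$, all of whose vertices have degree $3$ in $X$, and $V_3$, $V_8$ are the two parts of the bipartition of $X$. Give automorphism groups of graphs the topology of pointwise convergence on vertices, and let $\mathrm{Aut}(X)^+$ be the group of automorphisms of $X$ that preserve the bipartition of $X$ (each part being mapped to itself). For a topological group $G$, let $G^{(\infty)}$ be the intersection of all open subgroups of finite index of $G$, and call $G$ topologically simple if its only closed normal subgroups are $\{1\}$ and $G$. Let $\mathrm{Sub}(\mathrm{Aut}(T))$ be the set of closed subgroups of $\mathrm{Aut}(T)$ with the Chabauty topology, in which a base of neighborhoods of $H$ is given by the sets $\{J \mid J \cap K \subseteq HU \text{ and } H \cap K \subseteq JU\}$ with $K \subseteq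 \mathrm{Aut}(T)$ compact and $U \subseteq \mathrm{Aut}(T)$ an open neighborhood of the identity. Then there is a closed subgroup $H \leq \mathrm{Aut}(T)$ such that: 1. $H$ is isomorphic, as a topological group, to $\left(\prod_{v \in V_8} \mathrm{Alt}(5)\right) \rtimes \mathrm{Aut}(X)^+$, where $\mathrm{Aut}(X)^+$ acts on the product by permuting the coordinates through its action on $V_8$; 2. $H = H^{(\infty)}$; 3. $H$ is not a Chabauty limit of topologically simple closed subgroups of $\mathrm{Aut}(T)$, i.e. it is not in the closure of the set of these subgroups in $\mathrm{Sub}(\mathrm{Aut}(T))$. Moreover $H$ has exactly $3$ orbits of vertices on $T$. Consequently, for every integer $C \geq 3$, the Chabauty-closure of the set of topologically simple closed subgroups of $\mathrm{Aut}(T)$ with at most $C$ orbits of vertices is not equal to the set of closed subgroups $J$ of $\mathrm{Aut}(T)$ with at most $C$ orbits of vertices and $J = J^{(\infty)}$. -/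

import Mathlib

open scoped Pointwise

universe u v w

/-- A graph in the sense of Serre and Bass, with vertices `V` and oriented edges `E`: every oriented
edge has an origin, a terminus and a reverse edge different from itself. Multiple edges and loops
are allowed; a geometric edge is a pair `{e, rev e}`. -/
structure SerreGraph (V : Type u) (E : Type v) where
  origin : E → V
  terminus : E → V
  rev : E → E
  rev_rev : ∀ e, rev (rev e) = e
  rev_ne : ∀ e, rev e ≠ e
  origin_rev : ∀ e, origin (rev e) = terminus e

/-- A simple graph, viewed as a graph in the sense of Serre through its darts. -/
def SimpleGraph.toSerreGraph {V : Type u} (T : SimpleGraph V) : SerreGraph V T.Dart where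
  origin d := d.fst
  terminus d := d.snd
  rev d := d.symm
  rev_rev d := d.symm_symm
  rev_ne d := d.symm_ne
  origin_rev _ := rfl

/-- A covering of graphs: a morphism which, at every vertex `x`, maps the oriented edges with
origin `x` bijectively to the oriented edges with origin the image of `x`. -/
structure SerreGraph.Covering {V : Type u} {E : Type v} {V' : Type w} {E' : Type*}
    (A : SerreGraph V E) (B : SerreGraph V' E') where
  onVertices : V → V'
  onEdges : E → E'
  map_origin : ∀ e, B.origin (onEdges e) = onVertices (A.origin e)
  map_terminus : ∀ e, B.terminus (onEdges e) = onVertices (A.terminus e)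
  map_rev : ∀ e, onEdges (A.rev e) = B.rev (onEdges e)
  bijOn_star : ∀ x, Set.BijOn onEdges {e | A.origin e = x} {e | B.origin e = onVertices x}

/-- `T` is a universal covering tree of the connected graph `B`: it is a tree that covers `B`. -/
def SerreGraph.IsUniversalCoveringTree {V : Type u} {V' : Type v} {E' : Type w}
    (B : SerreGraph V' E') (T : SimpleGraph V) : Prop :=
  T.IsTree ∧ Nonempty (SerreGraph.Covering T.toSerreGraph B)

/-- The graph with seven vertices and eight geometric edges: the vertices `0` and `1` are joined by
three edges (numbered `0, 1, 2`), and `0` is joined by one edge to each of the vertices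
`2, 3, 4, 5, 6` (edges `3, 4, 5, 6, 7`). The edge `(i, false)` starts at the vertex `0`, and
`(i, true)` is its reverse. -/
def baseGraph : SerreGraph (Fin 7) (Fin 8 × Bool) where
  origin e := if e.2 then ![1, 1, 1, 2, 3, 4, 5, 6] e.1 else 0
  terminus e := if e.2 then 0 else ![1, 1, 1, 2, 3, 4, 5, 6] e.1
  rev e := (e.1, !e.2)
  rev_rev e := by simp
  rev_ne e := by rcases e with ⟨i, b⟩; cases b <;> simp
  origin_rev e := by rcases e with ⟨i, b⟩; cases b <;> simp

namespace SimpleGraph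

variable {V : Type u} (G : SimpleGraph V)

/-- The set of vertices of degree `n`. -/
def verticesOfDegree (n : ℕ) : Set V := {x | (G.neighborSet x).encard = n}

/-- The convex hull, in a tree, of a set of vertices: all vertices lying on a path between two
vertices of that set. -/
def treeHull (S : Set V) : Set V :=
  {x | ∃ a ∈ S, ∃ b ∈ S, ∃ p : G.Walk a b, p.IsPath ∧ x ∈ p.support}

/-- The topology of pointwise convergence on the automorphism group of a graph, the set of vertices
being discrete; this is the compact-open topology. -/
instance autTopology : TopologicalSpace (G ≃g G) :=
  TopologicalSpace.induced (fun g => (g : V → V))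
    (@Pi.topologicalSpace V (fun _ => V) (fun _ => ⊥))

/-- The group of type-preserving automorphisms of a connected bipartite graph: the automorphisms
that preserve the proper colorings with two colors. -/
def typePreserving : Subgroup (G ≃g G) where
  carrier := {g | ∀ (c : G.Coloring Bool) (x : V), c (g x) = c x}
  mul_mem' {g h} hg hh c x := by
    rw [RelIso.mul_apply, hg c (h x), hh c x]
  one_mem' _ _ := rfl
  inv_mem' {g} hg c x := by
    rw [← hg c (g⁻¹ x), RelIso.apply_inv_self]

/-- `B` is stable under all type-preserving automorphisms. -/
def IsTypeInvariant (B : Set V) : Prop :=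
  ∀ g ∈ G.typePreserving, ∀ x ∈ B, g x ∈ B

/-- The action of the group of type-preserving automorphisms on a set of vertices that is stable
under it. -/
abbrev typePreservingAction {B : Set V} (hB : G.IsTypeInvariant B) :
    MulAction G.typePreserving B where
  smul g x := ⟨g.1 x.1, hB g.1 g.2 x.1 x.2⟩
  one_smul _ := rfl
  mul_smul _ _ _ := rfl

/-- The action of the group of type-preserving automorphisms on the group `B → A` by permutation of
the coordinates: `(g • f) x = f (g⁻¹ x)`. -/
def permuteCoordinates {B : Set V} (hB : G.IsTypeInvariant B) (A : Type v) [Group A] :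
    G.typePreserving →* MulAut (B → A) :=
  letI := G.typePreservingAction hB
  letI : MulDistribMulAction G.typePreserving (B → A) := arrowMulDistribMulAction
  MulDistribMulAction.toMulAut G.typePreserving (B → A)

end SimpleGraph

/-- The product topology on a semidirect product of two topological groups. -/
instance semidirectProductTopology {N : Type u} {Q : Type v} [Group N] [Group Q]
    [TopologicalSpace N] [TopologicalSpace Q] (φ : Q →* MulAut N) :
    TopologicalSpace (N ⋊[φ] Q) :=
  TopologicalSpace.induced (fun x => (x.left, x.right)) inferInstance

/-- The finite group `Alt(n)` is discrete. -/
instance alternatingGroupTopology (n : ℕ) : TopologicalSpace (alternatingGroup (Fin n)) := ⊥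

section Chabauty

variable {G : Type u} [Group G] [TopologicalSpace G]

/-- The basic Chabauty neighborhood of the closed subgroup `H` given by `K` and `U`. -/
def chabautyNhd (H : ClosedSubgroup G) (K U : Set G) : Set (ClosedSubgroup G) :=
  {J | (J.toSubgroup : Set G) ∩ K ⊆ (H.toSubgroup : Set G) * U ∧
    (H.toSubgroup : Set G) ∩ K ⊆ (J.toSubgroup : Set G) * U}

theorem chabautyNhd_anti (H : ClosedSubgroup G) {K K' U U' : Set G} (hK : K ⊆ K') (hU : U' ⊆ U) :
    chabautyNhd H K' U' ⊆ chabautyNhd H K U := fun _ hJ =>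
  ⟨(Set.inter_subset_inter_right _ hK).trans (hJ.1.trans (Set.mul_subset_mul_left hU)),
    (Set.inter_subset_inter_right _ hK).trans (hJ.2.trans (Set.mul_subset_mul_left hU))⟩

/-- The Chabauty topology on the set of closed subgroups: the sets `chabautyNhd H K U`, for `K`
compact and `U` an open neighborhood of the identity, are a base of neighborhoods of `H`. -/
instance chabautyTopology : TopologicalSpace (ClosedSubgroup G) where
  IsOpen O := ∀ H ∈ O, ∃ K U : Set G, IsCompact K ∧ IsOpen U ∧ 1 ∈ U ∧ chabautyNhd H K U ⊆ O
  isOpen_univ _ _ := ⟨∅, Set.univ, isCompact_empty, isOpen_univ, trivial, Set.subset_univ _⟩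
  isOpen_inter O O' hO hO' H hH := by
    obtain ⟨K, U, hK, hU, h1, h⟩ := hO H hH.1
    obtain ⟨K', U', hK', hU', h1', h'⟩ := hO' H hH.2
    exact ⟨K ∪ K', U ∩ U', hK.union hK', hU.inter hU', ⟨h1, h1'⟩, Set.subset_inter
      ((chabautyNhd_anti H Set.subset_union_left Set.inter_subset_left).trans h)
      ((chabautyNhd_anti H Set.subset_union_right Set.inter_subset_right).trans h')⟩
  isOpen_sUnion S hS H hH := by
    obtain ⟨O, hO, hHO⟩ := hH
    obtain ⟨K, U, hK, hU, h1, h⟩ := hS O hO H hHO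
    exact ⟨K, U, hK, hU, h1, h.trans (Set.subset_sUnion_of_mem hO)⟩

end Chabauty

/-- A topological group is topologically simple if its only closed normal subgroups are the trivial
ones. -/
def IsTopologicallySimple (G : Type u) [Group G] [TopologicalSpace G] : Prop :=
  ∀ N : Subgroup G, N.Normal → IsClosed (N : Set G) → N = ⊥ ∨ N = ⊤

/-- The intersection of all open subgroups of finite index of a topological group. -/
def openFiniteResidual (G : Type u) [Group G] [TopologicalSpace G] : Subgroup G :=
  sInf {P | IsOpen (P : Set G) ∧ P.FiniteIndex}

/-- The number of orbits of vertices of a group of automorphisms of a graph. -/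
noncomputable def vertexOrbitCount {V : Type u} {T : SimpleGraph V} (H : Subgroup (T ≃g T)) : ℕ∞ :=
  ENat.card (MulAction.orbitRel.Quotient H V)

/-! The covering labels the edges of `X` by three colors and the leaves at each vertex of degree 8
by `Fin 5`. The group `H` consists of the automorphisms of `T` whose induced permutations of leaf
labels are all even. Since `T` is `X` with five leaves attached at each vertex of `V₈`, an
automorphism is an automorphism of `X` together with one permutation of labels per vertex of `V₈`.
This gives the semidirect product.

`H` has no proper open normal subgroup `P`. For `Aut(X)⁺` this is an argument in the style of Tits:
an open normal subgroup contains the fixators of all half-trees, hence of edges (independence of the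
two sides), hence of vertices, hence everything (`normal_open_eq_top`). In the product, `P` contains
all functions that are trivial on some finite set `F`. Conjugation by an element that moves `F` off
itself supplies those supported on `F`.

`H` is not a limit of simple groups because the local actions have coprime orders. Near `H`, a
closed group `J` contains some `j` that fixes `b` and acts as a 5-cycle on its leaves, and some `j'`
that moves `b`. The powers `j ^ 6 ^ m` become trivial on larger and larger balls of `X`, since 6 is
the order of `Sym(3)`, but they still act on the leaves at `b` by the same 5-cycle, since 6 is 1
modulo 5. A limit point is a nontrivial element of the kernel of `J` on `X`, and `j'` shows that
this closed normal subgroup is proper (`not_isTopologicallySimple`). -/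

/-! ### Edge-colored cubic trees and their automorphisms -/

namespace SimpleGraph

variable {W : Type u} {Γ : SimpleGraph W}

/-- An edge coloring of a cubic graph by `Fin 3`, every vertex having exactly one edge of each
color: `s i x` is the neighbor of `x` along the edge of color `i`. -/
structure Tricoloring (Γ : SimpleGraph W) where
  s : Fin 3 → W → W
  s_s : ∀ i x, s i (s i x) = x
  s_inj : ∀ i j x, s i x = s j x → i = j
  adj_iff : ∀ x y, Γ.Adj x y ↔ ∃ i, s i x = y

namespace Tricoloring

variable (S : Γ.Tricoloring)

theorem adj (i : Fin 3) (x : W) : Γ.Adj x (S.s i x) := (S.adj_iff _ _).2 ⟨i, rfl⟩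

/-- The color of a dart. -/
noncomputable def color (d : Γ.Dart) : Fin 3 := ((S.adj_iff _ _).1 d.adj).choose

theorem s_color (d : Γ.Dart) : S.s (S.color d) d.fst = d.snd :=
  ((S.adj_iff _ _).1 d.adj).choose_spec

theorem color_eq {d : Γ.Dart} {i : Fin 3} (h : S.s i d.fst = d.snd) : S.color d = i :=
  S.s_inj _ _ d.fst ((S.s_color d).trans h.symm)

/-- The permutation of the neighbors of a vertex `x` that a map fixing `x` induces. -/
theorem exists_perm {g : Γ ≃g Γ} {x : W} (hg : g x = x) :
    ∃ σ : Equiv.Perm (Fin 3), ∀ i, g (S.s i x) = S.s (σ i) x := by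
  have h : ∀ i, ∃ j, g (S.s i x) = S.s j x := fun i => by
    obtain ⟨j, hj⟩ := (S.adj_iff x (g (S.s i x))).1
      (by simpa [hg] using (g.map_rel_iff.2 (S.adj i x)))
    exact ⟨j, hj.symm⟩
  choose σ hσ using h
  have hinj : Function.Injective σ := fun i j hij =>
    S.s_inj i j x (g.injective (by rw [hσ, hσ, hij]))
  exact ⟨Equiv.ofBijective σ (Finite.injective_iff_bijective.1 hinj), hσ⟩

theorem eq_of_connected (hΓ : Γ.Connected) {f g : W → W} {σ : Equiv.Perm (Fin 3)}
    (hf : ∀ i z, f (S.s i z) = S.s (σ i) (f z)) (hg : ∀ i z, g (S.s i z) = S.s (σ i) (g z))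
    {x : W} (hx : f x = g x) : f = g := by
  funext y
  obtain ⟨p⟩ := hΓ.preconnected x y
  induction p with
  | nil => exact hx
  | cons h p ih =>
    obtain ⟨i, rfl⟩ := (S.adj_iff _ _).1 h
    exact ih (by rw [hf, hg, hx])

/-- The value at `z` is found by reading the colors along the path from `x` to `z` and following
their images under `σ` from `y`. For adjacent vertices, one of the two paths extends the other by a
single edge, which gives compatibility with the colors. -/
theorem exists_map (hΓ : Γ.IsTree) (x y : W) (σ : Equiv.Perm (Fin 3)) :
    ∃ f : W → W, f x = y ∧ ∀ i z, f (S.s i z) = S.s (σ i) (f z) := by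
  choose p hp using fun z => (hΓ.existsUnique_path x z).exists
  let f : W → W := fun z => ((p z).darts.map S.color).foldl (fun v i => S.s (σ i) v) y
  have hcon : ∀ (z : W) (i : Fin 3), z ∈ (p (S.s i z)).support →
      f (S.s i z) = S.s (σ i) (f z) := by
    intro z i hz
    have h := hΓ.isAcyclic.path_concat (hp z) (hp (S.s i z)) (S.adj i z) hz
    have hc : S.color ⟨(z, S.s i z), S.adj i z⟩ = i := S.color_eq rfl
    simp only [f]
    rw [h, Walk.darts_concat]
    simp [hc]
  refine ⟨f, ?_, fun i z => ?_⟩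
  · have : p x = Walk.nil := (hΓ.existsUnique_path x x).unique (hp x) Walk.IsPath.nil
    simp [f, this]
  · by_cases hz : z ∈ (p (S.s i z)).support
    · exact hcon z i hz
    · have h := hΓ.isAcyclic.mem_support_of_ne_mem_support_of_adj_of_isPath (hp z)
        (hp (S.s i z)) (S.adj i z) hz
      have h2 := hcon (S.s i z) i (by rwa [S.s_s])
      rw [S.s_s] at h2
      rw [h2, S.s_s]

/-- The automorphism of a cubic tree that takes `x` to `y` and permutes the colors by `σ`. -/
theorem exists_aut (hΓ : Γ.IsTree) (x y : W) (σ : Equiv.Perm (Fin 3)) :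
    ∃ g : Γ ≃g Γ, g x = y ∧ ∀ i z, g (S.s i z) = S.s (σ i) (g z) := by
  obtain ⟨f, hf, hfs⟩ := S.exists_map hΓ x y σ
  obtain ⟨g, hg, hgs⟩ := S.exists_map hΓ y x σ⁻¹
  -- Both the composite and the identity preserve colors and fix `x`, so they agree along every
  -- walk.
  have hgf : g ∘ f = id := S.eq_of_connected hΓ.connected (σ := 1) (x := x)
    (fun i z => by simp [hfs, hgs]) (fun i z => by simp) (by simp [hf, hg])
  have hfg : f ∘ g = id := S.eq_of_connected hΓ.connected (σ := 1) (x := y)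
    (fun i z => by simp [hfs, hgs]) (fun i z => by simp) (by simp [hf, hg])
  refine ⟨⟨⟨f, g, congrFun hgf, congrFun hfg⟩, fun {a b} => ?_⟩, hf, hfs⟩
  simp only [Equiv.coe_fn_mk, S.adj_iff]
  constructor
  · rintro ⟨i, hi⟩
    have hl : ∀ z, g (f z) = z := congrFun hgf
    have := congrArg g hi
    rw [hgs, hl, hl] at this
    exact ⟨σ⁻¹ i, this⟩
  · rintro ⟨i, rfl⟩
    exact ⟨σ i, (hfs i a).symm⟩

end Tricoloring

/-! ### Types of vertices and half-trees -/

theorem coloring_eq_iff (hΓ : Γ.Connected) (c c' : Γ.Coloring Bool) (x y : W) :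
    c x = c' x ↔ c y = c' y := by
  obtain ⟨p⟩ := hΓ.preconnected x y
  induction p with
  | nil => rfl
  | cons h p ih =>
    have h1 := c.valid h
    have h2 := c'.valid h
    rw [← ih]
    revert h1 h2
    cases c _ <;> cases c _ <;> cases c' _ <;> cases c' _ <;> simp

/-- Two 2-colorings of a connected graph agree everywhere or nowhere, so one coloring and one vertex
decide whether types are preserved. -/
theorem mem_typePreserving (hΓ : Γ.Connected) (c : Γ.Coloring Bool) {g : Γ ≃g Γ} {x : W}
    (hx : c (g x) = c x) : g ∈ Γ.typePreserving := by
  intro c' y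
  have h1 := coloring_eq_iff hΓ (c'.comp g.toHom : Γ.Coloring Bool) c' x y
  rw [show c' (g y) = (c'.comp g.toHom : Γ.Coloring Bool) y from rfl, ← h1]
  change c' (g x) = c' x
  have h2 := coloring_eq_iff hΓ c c' x (g x)
  revert h2 hx
  cases c _ <;> cases c _ <;> cases c' _ <;> cases c' _ <;> simp

/-- The half-tree that contains `b` and not `a`, for an edge `ab` of a tree. -/
def halfTree (Γ : SimpleGraph W) (a b : W) : Set W :=
  {z | (Γ.deleteEdges {s(a, b)}).Reachable b z}

theorem mem_halfTree (a b : W) : b ∈ Γ.halfTree a b := Reachable.refl _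

theorem notMem_halfTree (hΓ : Γ.IsAcyclic) {a b : W} (h : Γ.Adj a b) : a ∉ Γ.halfTree a b :=
  fun h' => isAcyclic_iff_forall_adj_isBridge.1 hΓ h h'.symm

theorem mem_halfTree_of_adj {a b z z' : W} (hz : z ∈ Γ.halfTree a b)
    (h : Γ.Adj z z') (hne : s(z, z') ≠ s(a, b)) : z' ∈ Γ.halfTree a b :=
  Reachable.trans hz (Adj.reachable (by simpa [deleteEdges_adj, h] using hne))

theorem eq_of_adj_halfTree {a b z z' : W}
    (hz : z ∈ Γ.halfTree a b) (hz' : z' ∉ Γ.halfTree a b) (h : Γ.Adj z z') : z = b ∧ z' = a := by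
  have h1 : s(z, z') = s(a, b) := by
    by_contra hne
    exact hz' (mem_halfTree_of_adj hz h hne)
  rcases Sym2.eq_iff.1 h1 with ⟨rfl, rfl⟩ | ⟨rfl, rfl⟩
  · exact absurd (mem_halfTree _ _) hz'
  · exact ⟨rfl, rfl⟩

theorem mem_support_of_leaves_halfTree {a b z z' : W}
    (hz : z ∈ Γ.halfTree a b) (hz' : z' ∉ Γ.halfTree a b) (p : Γ.Walk z z') : a ∈ p.support := by
  induction p with
  | nil => exact absurd hz hz'
  | @cons u v w h p ih =>
    by_cases hv : v ∈ Γ.halfTree a b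
    · exact List.mem_cons_of_mem _ (ih hv hz')
    · rw [← (eq_of_adj_halfTree hz hv h).2]
      exact List.mem_cons_of_mem _ p.start_mem_support

theorem map_mem_halfTree {a b : W} {g : Γ ≃g Γ} (ha : g a = a) (hb : g b = b)
    {z : W} (hz : z ∈ Γ.halfTree a b) : g z ∈ Γ.halfTree a b := by
  obtain ⟨p⟩ := hz
  suffices ∀ (u v : W) (_ : (Γ.deleteEdges {s(a, b)}).Walk u v), u ∈ Γ.halfTree a b →
      g u ∈ Γ.halfTree a b → g v ∈ Γ.halfTree a b from
    this _ _ p (mem_halfTree _ _) (by rw [hb]; exact mem_halfTree _ _)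
  intro u v p
  induction p with
  | nil => exact fun _ h => h
  | cons h p ih =>
    intro hu hgu
    rw [deleteEdges_adj] at h
    refine ih (mem_halfTree_of_adj hu h.1 h.2) (mem_halfTree_of_adj hgu (g.map_rel_iff.2 h.1) ?_)
    intro he
    apply h.2
    have := congrArg (Sym2.map g.symm) he
    have ha' : g.symm a = a := by rw [RelIso.symm_apply_eq, ha]
    have hb' : g.symm b = b := by rw [RelIso.symm_apply_eq, hb]
    simpa [ha', hb'] using this

open Classical in
/-- An automorphism that fixes the ends of an edge can be modified to be the identity outside one of
the two half-trees. -/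
theorem exists_restrict_halfTree {a b : W} {g : Γ ≃g Γ}
    (ha : g a = a) (hb : g b = b) :
    ∃ k : Γ ≃g Γ, (∀ z ∈ Γ.halfTree a b, k z = g z) ∧ ∀ z ∉ Γ.halfTree a b, k z = z := by
  let F : (Γ ≃g Γ) → W → W := fun g z => if z ∈ Γ.halfTree a b then g z else z
  have hadj : ∀ g : Γ ≃g Γ, g a = a → g b = b → ∀ x y, Γ.Adj x y → Γ.Adj (F g x) (F g y) := by
    intro g ha hb x y h
    by_cases hx : x ∈ Γ.halfTree a b <;> by_cases hy : y ∈ Γ.halfTree a b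
    · simpa only [F, hx, hy, if_true] using g.map_rel_iff.2 h
    · obtain ⟨rfl, rfl⟩ := eq_of_adj_halfTree hx hy h
      simpa [F, hx, hy, hb] using h
    · obtain ⟨rfl, rfl⟩ := eq_of_adj_halfTree hy hx h.symm
      simpa [F, hx, hy, hb] using h
    · simpa [F, hx, hy] using h
  have hinv : ∀ g k : Γ ≃g Γ, g a = a → g b = b → (∀ z, k (g z) = z) → ∀ z, F k (F g z) = z := by
    intro g k ha hb hk z
    by_cases hz : z ∈ Γ.halfTree a b
    · simp [F, hz, map_mem_halfTree ha hb hz, hk]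
    · simp [F, hz]
  have ha' : g.symm a = a := by rw [RelIso.symm_apply_eq, ha]
  have hb' : g.symm b = b := by rw [RelIso.symm_apply_eq, hb]
  have h1 := hinv g g.symm ha hb (by simp)
  have h2 := hinv g.symm g ha' hb' (by simp)
  refine ⟨⟨⟨F g, F g.symm, h1, h2⟩, fun {x y} => ⟨fun h => ?_, hadj g ha hb x y⟩⟩,
    fun z hz => by simp [F, hz], fun z hz => by simp [F, hz]⟩
  have := hadj g.symm ha' hb' _ _ h
  simpa [h1] using this

namespace Tricoloring

/-- Otherwise all three neighbors of `z` would be closer to `a`, but only the penultimate vertex of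
the path from `a` to `z` is. -/
theorem exists_adj_dist (S : Γ.Tricoloring) (hΓ : Γ.IsTree) (a z : W) :
    ∃ z', Γ.Adj z z' ∧ Γ.dist a z' = Γ.dist a z + 1 := by
  by_contra! hcon
  have h : ∀ i, Γ.dist a z = Γ.dist a (S.s i z) + 1 := fun i =>
    (hΓ.dist_eq_dist_add_one_of_adj a (S.adj i z)).resolve_right (hcon _ (S.adj i z))
  obtain ⟨p, hp, hl⟩ := hΓ.connected.exists_path_of_dist a z
  have h2 : ∀ i, S.s i z = p.penultimate := fun i => by
    refine hΓ.isAcyclic.eq_penultimate_of_adj_end hp (S.adj i z) ?_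
    by_contra hn
    obtain ⟨q, hq, hql⟩ := hΓ.connected.exists_path_of_dist a (S.s i z)
    have := hΓ.isAcyclic.path_concat hp hq (S.adj i z)
      (by_contra fun hz => hn
        (hΓ.isAcyclic.mem_support_of_ne_mem_support_of_adj_of_isPath hp hq (S.adj i z) hz))
    have h3 := congrArg Walk.length this
    rw [Walk.length_concat, hl, hql, h i] at h3
    lia
  exact absurd (S.s_inj 0 1 z ((h2 0).trans (h2 1).symm)) (by decide)

theorem exists_mem_halfTree_dist (S : Γ.Tricoloring) (hΓ : Γ.IsTree) {a b : W}
    (hab : Γ.Adj a b) (n : ℕ) : ∃ z ∈ Γ.halfTree a b, Γ.dist a z = n + 1 := by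
  induction n with
  | zero => exact ⟨b, mem_halfTree _ _, dist_eq_one_iff_adj.2 hab⟩
  | succ n ih =>
    obtain ⟨z, hz, hd⟩ := ih
    obtain ⟨z', hz', hd'⟩ := S.exists_adj_dist hΓ a z
    refine ⟨z', mem_halfTree_of_adj hz hz' ?_, by rw [hd', hd]⟩
    intro he
    rcases Sym2.eq_iff.1 he with ⟨rfl, rfl⟩ | ⟨rfl, rfl⟩
    · exact notMem_halfTree hΓ.isAcyclic hab hz
    · simp at hd'

/-- A half-tree contains vertices of the same type as the root of its complement, arbitrarily far
away. -/
theorem exists_mem_halfTree_far (S : Γ.Tricoloring) (hΓ : Γ.IsTree)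
    (c : Γ.Coloring Bool) {a b : W} (hab : Γ.Adj a b) (n : ℕ) :
    ∃ z ∈ Γ.halfTree a b, n < Γ.dist a z ∧ c z = c a := by
  obtain ⟨z, hz, hd⟩ := S.exists_mem_halfTree_dist hΓ hab n
  by_cases hc : c z = c a
  · exact ⟨z, hz, by lia, hc⟩
  -- Types alternate along edges, so one further step away from `a` corrects the type.
  obtain ⟨z', hz', hd'⟩ := S.exists_adj_dist hΓ a z
  refine ⟨z', mem_halfTree_of_adj hz hz' ?_, by lia, ?_⟩
  · intro he
    rcases Sym2.eq_iff.1 he with ⟨rfl, rfl⟩ | ⟨rfl, rfl⟩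
    · exact notMem_halfTree hΓ.isAcyclic hab hz
    · simp at hd'
  · have := c.valid hz'
    revert hc this
    cases c _ <;> cases c _ <;> cases c _ <;> simp

end Tricoloring

end SimpleGraph

/-! ### The permutation topology on automorphism groups -/

namespace SimpleGraph

variable {V : Type u} {G : SimpleGraph V}

theorem mem_nhds_aut {g : G ≃g G} {U : Set (G ≃g G)} :
    U ∈ nhds g ↔ ∃ F : Finset V, ∀ h : G ≃g G, (∀ x ∈ F, h x = g x) → h ∈ U := by
  let _ : TopologicalSpace V := ⊥
  have : DiscreteTopology V := ⟨rfl⟩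
  have hi : nhds g = Filter.comap (fun g : G ≃g G => (g : V → V)) (nhds (g : V → V)) :=
    nhds_induced _ _
  rw [hi, Filter.mem_comap]
  simp only [nhds_pi, nhds_discrete, Filter.mem_pi', Filter.mem_pure]
  constructor
  · rintro ⟨t, ⟨F, s, hs, hst⟩, htU⟩
    refine ⟨F, fun h hF => htU (hst ?_)⟩
    intro x hx
    change h x ∈ s x
    rw [hF x hx]
    exact hs x
  · rintro ⟨F, hF⟩
    exact ⟨{k | ∀ x ∈ F, k x = g x}, ⟨F, fun x => {g x}, fun x => rfl,
      fun k hk x hx => hk x hx⟩, fun h hh => hF h hh⟩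

theorem isOpen_aut_iff {U : Set (G ≃g G)} :
    IsOpen U ↔ ∀ g ∈ U, ∃ F : Finset V, ∀ h : G ≃g G, (∀ x ∈ F, h x = g x) → h ∈ U := by
  simp only [isOpen_iff_mem_nhds, mem_nhds_aut]

theorem isOpen_apply_eq (x y : V) : IsOpen {g : G ≃g G | g x = y} :=
  isOpen_aut_iff.2 fun g hg => ⟨{x}, fun h hh => (hh x (by simp)).trans hg⟩

theorem isClosed_apply_eq (x y : V) : IsClosed {g : G ≃g G | g x = y} :=
  ⟨isOpen_aut_iff.2 fun g hg => ⟨{x}, fun h hh => by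
    change ¬ (h x = y)
    rw [hh x (by simp)]
    exact hg⟩⟩

theorem continuous_aut_iff {A : Type*} [TopologicalSpace A] {f : A → (G ≃g G)} :
    Continuous f ↔ ∀ x y, IsOpen {a | f a x = y} := by
  constructor
  · exact fun hf x y => (isOpen_apply_eq x y).preimage hf
  · intro h
    rw [continuous_iff_continuousAt]
    intro a U hU
    obtain ⟨F, hF⟩ := mem_nhds_aut.1 hU
    rw [Filter.mem_map]
    refine Filter.mem_of_superset (x := ⋂ x ∈ F, {b | f b x = f a x}) ?_ ?_
    · exact (Filter.biInter_finset_mem F).2 fun x _ => (h x _).mem_nhds rfl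
    · intro b hb
      exact hF _ (by simpa using hb)

instance autIsTopologicalGroup : IsTopologicalGroup (G ≃g G) where
  continuous_mul := continuous_aut_iff.2 fun x y => by
    have : {a : (G ≃g G) × (G ≃g G) | (a.1 * a.2) x = y} =
        ⋃ z, {g : G ≃g G | g z = y} ×ˢ {g : G ≃g G | g x = z} := by
      ext a
      simp [RelIso.mul_apply]
    rw [this]
    exact isOpen_iUnion fun z => (isOpen_apply_eq z y).prod (isOpen_apply_eq x z)
  continuous_inv := continuous_aut_iff.2 fun x y => by
    have : {a : G ≃g G | a⁻¹ x = y} = {a | a y = x} := by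
      ext a
      exact ⟨fun h => by simp [← (show a⁻¹ x = y from h)],
        fun h => by simp [← (show a y = x from h)]⟩
    rw [this]
    exact isOpen_apply_eq y x

end SimpleGraph

/-! ### Open normal subgroups of the type-preserving group -/

namespace SimpleGraph

variable {W : Type u} {Γ : SimpleGraph W}

theorem exists_finset_of_isOpen_subgroup {P : Subgroup Γ.typePreserving}
    (hP : IsOpen (P : Set Γ.typePreserving)) :
    ∃ F : Finset W, ∀ g : Γ.typePreserving, (∀ x ∈ F, g.1 x = x) → g ∈ P := by
  obtain ⟨U, hU, hUP⟩ := isOpen_induced_iff.1 hP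
  have h1 : (1 : Γ ≃g Γ) ∈ U := by
    have : (1 : Γ.typePreserving) ∈ Subtype.val ⁻¹' U := hUP ▸ P.one_mem
    exact this
  obtain ⟨F, hF⟩ := isOpen_aut_iff.1 hU 1 h1
  refine ⟨F, fun g hg => ?_⟩
  have : g ∈ Subtype.val ⁻¹' U := hF _ hg
  rwa [hUP] at this

theorem dist_map (g : Γ ≃g Γ) (hΓ : Γ.Connected) (x y : W) : Γ.dist (g x) (g y) ≤ Γ.dist x y := by
  obtain ⟨p, hp⟩ := hΓ.exists_walk_length_eq_dist x y
  rw [← hp, ← p.length_map g.toHom]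
  exact dist_le _

namespace Tricoloring

theorem exists_typePreserving (S : Γ.Tricoloring) (hΓ : Γ.IsTree) (c : Γ.Coloring Bool) {x y : W}
    (h : c x = c y) : ∃ g ∈ Γ.typePreserving, g x = y := by
  obtain ⟨g, hg, -⟩ := S.exists_aut hΓ x y 1
  exact ⟨g, mem_typePreserving hΓ.connected c (x := x) (by rw [hg, h]), hg⟩

/-- A type-preserving `k` carries `a` to a vertex `z` of the half-tree whose distance from `a`
exceeds the radius of `F` about `a`. A walk from `z` out of the half-tree passes through `a`, so it
is too long to end in the image of `F`. -/
theorem exists_map_finset_halfTree (S : Γ.Tricoloring) (hΓ : Γ.IsTree) (c : Γ.Coloring Bool)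
    {a b : W} (hab : Γ.Adj a b) (F : Finset W) :
    ∃ k ∈ Γ.typePreserving, ∀ x ∈ F, k x ∈ Γ.halfTree a b := by
  obtain ⟨z, hz, hd, hc⟩ := S.exists_mem_halfTree_far hΓ c hab (F.sup (Γ.dist a))
  obtain ⟨k, hk, hka⟩ := S.exists_typePreserving hΓ c hc.symm
  refine ⟨k, hk, fun x hx => ?_⟩
  by_contra hn
  obtain ⟨p, hp⟩ := hΓ.connected.exists_walk_length_eq_dist z (k x)
  have ha := mem_support_of_leaves_halfTree hz hn p
  classical
  have h1 : Γ.dist z a ≤ p.length :=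
    (dist_le (p.takeUntil a ha)).trans (p.length_takeUntil_le_length ha)
  have h2 : Γ.dist z (k x) ≤ Γ.dist a x := hka ▸ dist_map k hΓ.connected a x
  have h3 : Γ.dist a x ≤ F.sup (Γ.dist a) := Finset.le_sup hx
  rw [dist_comm] at hd
  lia

theorem exists_map_finset_disjoint (S : Γ.Tricoloring) (hΓ : Γ.IsTree) (c : Γ.Coloring Bool)
    (F : Finset W) : ∃ k ∈ Γ.typePreserving, ∀ x ∈ F, k x ∉ F := by
  obtain ⟨a⟩ := hΓ.connected.nonempty
  -- Beyond twice the radius of `F`, the balls around `a` and `z` are disjoint.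
  obtain ⟨z, hz, hd, hc⟩ := S.exists_mem_halfTree_far hΓ c (S.adj 0 a)
    (F.sup (Γ.dist a) + F.sup (Γ.dist a))
  obtain ⟨k, hk, hka⟩ := S.exists_typePreserving hΓ c hc.symm
  refine ⟨k, hk, fun x hx hkx => ?_⟩
  have h1 : Γ.dist a (k x) ≤ F.sup (Γ.dist a) := Finset.le_sup hkx
  have h2 : Γ.dist z (k x) ≤ Γ.dist a x := hka ▸ dist_map k hΓ.connected a x
  have h3 : Γ.dist a x ≤ F.sup (Γ.dist a) := Finset.le_sup hx
  have h4 : Γ.dist a z ≤ Γ.dist a (k x) + Γ.dist (k x) z := hΓ.connected.dist_triangle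
  rw [dist_comm (u := k x)] at h4
  lia

section NormalOpen

variable {P : Subgroup Γ.typePreserving}

/-- `P` contains the fixator of a finite set `F`. Once `k` moves `F` into the half-tree, the
conjugate of `g` by `k⁻¹` fixes `F`, and normality returns `g`. -/
theorem mem_of_fixes_halfTree (S : Γ.Tricoloring) (hΓ : Γ.IsTree) (c : Γ.Coloring Bool)
    [P.Normal] (hP : IsOpen (P : Set Γ.typePreserving)) {a b : W} (hab : Γ.Adj a b)
    {g : Γ.typePreserving} (hg : ∀ z ∈ Γ.halfTree a b, g.1 z = z) : g ∈ P := by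
  obtain ⟨F, hF⟩ := exists_finset_of_isOpen_subgroup hP
  obtain ⟨k, hk, hkF⟩ := S.exists_map_finset_halfTree hΓ c hab F
  let k' : Γ.typePreserving := ⟨k, hk⟩
  have h : k'⁻¹ * g * k' ∈ P := hF _ fun x hx => by
    change k⁻¹ (g.1 (k x)) = x
    rw [hg _ (hkF x hx), RelIso.inv_apply_self]
  have := (inferInstance : P.Normal).conj_mem _ h k'
  simpa [mul_assoc] using this

/-- Independence: an automorphism fixing both ends of an edge is a product of two factors, each
trivial on one of the half-trees. -/
theorem mem_of_fixes_edge (S : Γ.Tricoloring) (hΓ : Γ.IsTree) (c : Γ.Coloring Bool)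
    [P.Normal] (hP : IsOpen (P : Set Γ.typePreserving)) {a b : W} (hab : Γ.Adj a b)
    {g : Γ.typePreserving} (ha : g.1 a = a) (hb : g.1 b = b) : g ∈ P := by
  obtain ⟨k, hk, hk'⟩ := exists_restrict_halfTree ha hb
  have hkt : k ∈ Γ.typePreserving := mem_typePreserving hΓ.connected c (x := a)
    (by rw [hk' a (notMem_halfTree hΓ.isAcyclic hab)])
  have h1 : (⟨k, hkt⟩ : Γ.typePreserving) ∈ P := by
    refine S.mem_of_fixes_halfTree hΓ c hP hab.symm fun z hz => hk' z fun hz' => ?_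
    have hz1 : (Γ.deleteEdges {s(a, b)}).Reachable a z := by
      have : (Γ.deleteEdges {s(b, a)}).Reachable a z := hz
      rwa [Sym2.eq_swap] at this
    exact notMem_halfTree hΓ.isAcyclic hab (Reachable.trans hz' hz1.symm)
  have h2 : (⟨k, hkt⟩ : Γ.typePreserving)⁻¹ * g ∈ P := by
    refine S.mem_of_fixes_halfTree hΓ c hP hab fun z hz => ?_
    change k⁻¹ (g.1 z) = z
    rw [← hk z hz, RelIso.inv_apply_self]
  simpa using P.mul_mem h1 h2

/-- The permutation at `a` is a product of transpositions. A transposition of three colors fixes one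
color, so it is realized by an automorphism fixing an edge at `a`; dividing these out leaves one
that fixes all neighbors of `a`. -/
theorem mem_of_fixes_vertex (S : Γ.Tricoloring) (hΓ : Γ.IsTree) (c : Γ.Coloring Bool)
    [P.Normal] (hP : IsOpen (P : Set Γ.typePreserving)) {a : W}
    {g : Γ.typePreserving} (ha : g.1 a = a) : g ∈ P := by
  obtain ⟨σ, hσ⟩ := S.exists_perm ha
  induction σ using Equiv.Perm.swap_induction_on generalizing g with
  | one => exact S.mem_of_fixes_edge hΓ c hP (S.adj 0 a) ha (hσ 0)
  | swap_mul τ i j hij ih =>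
    obtain ⟨k, hk, hks⟩ := S.exists_aut hΓ a a (Equiv.swap i j)
    have hkt : k ∈ Γ.typePreserving := mem_typePreserving hΓ.connected c (x := a) (by rw [hk])
    have hkP : (⟨k, hkt⟩ : Γ.typePreserving) ∈ P := by
      obtain ⟨l, hl⟩ := (by decide : ∀ i j : Fin 3, ∃ l, Equiv.swap i j l = l) i j
      exact S.mem_of_fixes_edge hΓ c hP (S.adj l a) hk (by rw [hks, hk, hl])
    have h2 : (⟨k, hkt⟩ : Γ.typePreserving) * g ∈ P := by
      refine ih (g := ⟨k, hkt⟩ * g) ?_ fun l => ?_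
      · change k (g.1 a) = a
        rw [ha, hk]
      · change k (g.1 (S.s l a)) = _
        rw [hσ, hks, hk]
        simp
    exact (P.mul_mem_cancel_left hkP).1 h2

/-- The group of type-preserving automorphisms of the cubic tree has no proper open normal
subgroup. -/
theorem normal_open_eq_top (S : Γ.Tricoloring) (hΓ : Γ.IsTree) (c : Γ.Coloring Bool)
    [P.Normal] (hP : IsOpen (P : Set Γ.typePreserving)) : P = ⊤ := by
  obtain ⟨a⟩ := hΓ.connected.nonempty
  -- Vertex stabilizers lie in `P` and are transitive on the neighbors of the vertex.
  have key : ∀ x y z : W, Γ.Adj x y → Γ.Adj x z → ∃ k ∈ P, k.1 y = z := by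
    intro x y z hy hz
    obtain ⟨i, rfl⟩ := (S.adj_iff _ _).1 hy
    obtain ⟨j, rfl⟩ := (S.adj_iff _ _).1 hz
    obtain ⟨k, hk, hks⟩ := S.exists_aut hΓ x x (Equiv.swap i j)
    have hkt : k ∈ Γ.typePreserving := mem_typePreserving hΓ.connected c (x := x) (by rw [hk])
    exact ⟨⟨k, hkt⟩, S.mem_of_fixes_vertex hΓ c hP hk, by simp [hks, hk]⟩
  -- `P` folds every walk from `a` onto the single edge from `a` to `S.s 0 a`, one step at a time.
  have hmove : ∀ (x y : W) (_ : Γ.Walk x y), (∃ h ∈ P, h.1 x = a ∨ h.1 x = S.s 0 a) →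
      ∃ h ∈ P, h.1 y = a ∨ h.1 y = S.s 0 a := by
    intro x y p
    induction p with
    | nil => exact id
    | @cons x x' y hadj p ih =>
      rintro ⟨h, hP, hx⟩
      apply ih
      have hadj' : Γ.Adj (h.1 x) (h.1 x') := h.1.map_rel_iff.2 hadj
      rcases hx with hx | hx
      · rw [hx] at hadj'
        obtain ⟨k, hk, hka⟩ := key _ _ _ hadj' (S.adj 0 a)
        exact ⟨k * h, P.mul_mem hk hP, Or.inr hka⟩
      · rw [hx] at hadj'
        obtain ⟨k, hk, hka⟩ := key _ _ _ hadj' (S.adj 0 a).symm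
        exact ⟨k * h, P.mul_mem hk hP, Or.inl hka⟩
  rw [eq_top_iff]
  intro g _
  obtain ⟨p⟩ := hΓ.connected.preconnected a (g.1 a)
  obtain ⟨h, hh, hga⟩ := hmove _ _ p ⟨1, P.one_mem, Or.inl rfl⟩
  have hfix : h.1 (g.1 a) = a := by
    refine hga.resolve_right fun h' => c.valid (S.adj 0 a) ?_
    rw [← h', h.2 c, g.2 c]
  exact (P.mul_mem_cancel_left hh).1 (S.mem_of_fixes_vertex hΓ c hP (g := h * g) hfix)

end NormalOpen

end Tricoloring

end SimpleGraph

/-! ### Attaching leaves: automorphisms as a semidirect product -/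

namespace SimpleGraph

variable {V : Type u} {T : SimpleGraph V} {X : Set V}

/-- The restriction of automorphisms to an invariant induced subgraph. -/
def restrictHom (hX : ∀ (h : T ≃g T), ∀ x ∈ X, h x ∈ X) :
    (T ≃g T) →* (T.induce X ≃g T.induce X) where
  toFun h :=
    { toFun := fun x => ⟨h x, hX h x x.2⟩
      invFun := fun x => ⟨h⁻¹ x, hX h⁻¹ x x.2⟩
      left_inv := fun x => Subtype.ext (RelIso.inv_apply_self h x.1)
      right_inv := fun x => Subtype.ext (RelIso.apply_inv_self h x.1)
      map_rel_iff' := h.map_rel_iff }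
  map_one' := rfl
  map_mul' _ _ := rfl

/-- The action of a type-preserving automorphism on an invariant set of vertices. -/
def moveIn {W : Type v} {Γ : SimpleGraph W} {B : Set W} (hB : Γ.IsTypeInvariant B)
    (g : Γ.typePreserving) (b : B) : B :=
  ⟨g.1 b.1, hB g.1 g.2 b.1 b.2⟩

theorem moveIn_mul {W : Type v} {Γ : SimpleGraph W} {B : Set W} (hB : Γ.IsTypeInvariant B)
    (g k : Γ.typePreserving) (b : B) : moveIn hB (g * k) b = moveIn hB g (moveIn hB k b) := rfl

@[simp] theorem moveIn_inv_moveIn {W : Type v} {Γ : SimpleGraph W} {B : Set W}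
    (hB : Γ.IsTypeInvariant B) (g : Γ.typePreserving) (b : B) :
    moveIn hB g⁻¹ (moveIn hB g b) = b := by
  rw [← moveIn_mul, inv_mul_cancel]; rfl

@[simp] theorem moveIn_moveIn_inv {W : Type v} {Γ : SimpleGraph W} {B : Set W}
    (hB : Γ.IsTypeInvariant B) (g : Γ.typePreserving) (b : B) :
    moveIn hB g (moveIn hB g⁻¹ b) = b := by
  rw [← moveIn_mul, mul_inv_cancel]; rfl

theorem permuteCoordinates_apply {W : Type v} {Γ : SimpleGraph W} {B : Set W}
    (hB : Γ.IsTypeInvariant B) (A : Type w) [Group A] (g : Γ.typePreserving) (f : B → A) (b : B) :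
    Γ.permuteCoordinates hB A g f b = f (moveIn hB g⁻¹ b) := rfl

/-- The graph `T` is obtained from its induced subgraph on `X` by attaching `n` leaves to each
vertex of `B`. All automorphisms of `T` preserve `X` and are type-preserving on `X`. -/
structure LeafData (T : SimpleGraph V) (X : Set V) (B : Set X) (n : ℕ) where
  e : X ⊕ (B × Fin n) ≃ V
  e_inl : ∀ x, e (Sum.inl x) = x
  adj_leaf : ∀ p v, T.Adj (e (Sum.inr p)) v ↔ v = p.1.1.1
  invariant : (T.induce X).IsTypeInvariant B
  map_mem : ∀ (h : T ≃g T), ∀ x ∈ X, h x ∈ X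
  restrict_mem : ∀ h : T ≃g T, restrictHom map_mem h ∈ (T.induce X).typePreserving

namespace LeafData

variable {B : Set X} {n : ℕ} (L : T.LeafData X B n)

/-- The `i`-th leaf at `b`. -/
def leaf (b : B) (i : Fin n) : V := L.e (Sum.inr (b, i))

/-- The action of an automorphism on the subgraph `X`. -/
def res : (T ≃g T) →* (T.induce X).typePreserving where
  toFun h := ⟨restrictHom L.map_mem h, L.restrict_mem h⟩
  map_one' := rfl
  map_mul' _ _ := rfl

theorem res_apply (h : T ≃g T) (x : X) : ((L.res h).1 x : V) = h x := rfl

/-- The action of a type-preserving automorphism of `X` on `B`. -/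
def move (g : (T.induce X).typePreserving) (b : B) : B := moveIn L.invariant g b

theorem move_apply (h : T ≃g T) (b : B) : ((L.move (L.res h) b).1 : V) = h b.1 := rfl

theorem move_mul (g k : (T.induce X).typePreserving) (b : B) :
    L.move (g * k) b = L.move g (L.move k b) := rfl

@[simp] theorem move_inv_move (g : (T.induce X).typePreserving) (b : B) :
    L.move g⁻¹ (L.move g b) = b := moveIn_inv_moveIn _ _ _

@[simp] theorem move_move_inv (g : (T.induce X).typePreserving) (b : B) :
    L.move g (L.move g⁻¹ b) = b := moveIn_moveIn_inv _ _ _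

theorem move_inv_eq {g : (T.induce X).typePreserving} {b c : B} :
    L.move g⁻¹ b = c ↔ L.move g c = b :=
  ⟨fun h => by rw [← h, move_move_inv], fun h => by rw [← h, move_inv_move]⟩

theorem leaf_inj {b c : B} {i j : Fin n} : L.leaf b i = L.leaf c j ↔ b = c ∧ i = j := by
  simp [leaf]

theorem leaf_notMem (b : B) (i : Fin n) : L.leaf b i ∉ X := fun h => by
  have := L.e_inl ⟨_, h⟩
  exact Sum.inl_ne_inr (L.e.injective this)

theorem exists_leaf {v : V} (hv : v ∉ X) : ∃ b i, v = L.leaf b i := by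
  obtain ⟨x | ⟨b, i⟩, rfl⟩ := L.e.surjective v
  · exact absurd ((L.e_inl x).symm ▸ x.2) hv
  · exact ⟨b, i, rfl⟩

theorem leaf_adj (b : B) (i : Fin n) {v : V} : T.Adj (L.leaf b i) v ↔ v = b.1.1 :=
  L.adj_leaf _ _

/-- The permutation of the leaves given by permutations of the leaves at each vertex of `B` and an
automorphism of `X`. -/
def leafEquiv (f : B → Equiv.Perm (Fin n)) (g : (T.induce X).typePreserving) :
    B × Fin n ≃ B × Fin n where
  toFun p := (L.move g p.1, f (L.move g p.1) p.2)
  invFun p := (L.move g⁻¹ p.1, (f p.1)⁻¹ p.2)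
  left_inv p := by simp
  right_inv p := by simp

/-- The automorphism of `T` given by permutations of the leaves at each vertex of `B` and an
automorphism of `X`. -/
def glue (f : B → Equiv.Perm (Fin n)) (g : (T.induce X).typePreserving) : T ≃g T where
  toEquiv := L.e.symm.trans ((Equiv.sumCongr g.1.toEquiv (L.leafEquiv f g)).trans L.e)
  map_rel_iff' := by
    have hleaf : ∀ (p : B × Fin n) (y : X ⊕ (B × Fin n)),
        T.Adj (L.e (Sum.inr (L.leafEquiv f g p)))
          (L.e (Equiv.sumCongr g.1.toEquiv (L.leafEquiv f g) y)) ↔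
        T.Adj (L.e (Sum.inr p)) (L.e y) := by
      rintro ⟨b, i⟩ (y | ⟨c, j⟩)
      · rw [L.adj_leaf, L.adj_leaf]
        change L.e (Sum.inl (g.1 y)) = (g.1 b.1).1 ↔ _
        rw [L.e_inl, L.e_inl, ← Subtype.ext_iff, ← Subtype.ext_iff]
        exact g.1.injective.eq_iff
      · rw [L.adj_leaf, L.adj_leaf]
        exact iff_of_false (fun h => Sum.inl_ne_inr (L.e.injective ((L.e_inl _).trans h.symm)))
          (fun h => Sum.inl_ne_inr (L.e.injective ((L.e_inl _).trans h.symm)))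
    intro a b
    obtain ⟨x, rfl⟩ := L.e.surjective a
    obtain ⟨y, rfl⟩ := L.e.surjective b
    simp only [Equiv.trans_apply, Equiv.symm_apply_apply]
    rcases x with x | p
    · rcases y with y | q
      · change T.Adj (L.e (Sum.inl (g.1 x))) (L.e (Sum.inl (g.1 y))) ↔ _
        rw [L.e_inl, L.e_inl, L.e_inl, L.e_inl]
        exact g.1.map_rel_iff
      · rw [T.adj_comm, T.adj_comm (L.e (Sum.inl x))]
        exact hleaf q (Sum.inl x)
    · exact hleaf p y

theorem glue_apply (f : B → Equiv.Perm (Fin n)) (g : (T.induce X).typePreserving) (x : X) :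
    L.glue f g x = g.1 x := by
  conv_lhs => rw [← L.e_inl x]
  change L.e (Equiv.sumCongr g.1.toEquiv (L.leafEquiv f g) (L.e.symm (L.e (Sum.inl x)))) = _
  rw [Equiv.symm_apply_apply]
  exact L.e_inl _

theorem glue_leaf (f : B → Equiv.Perm (Fin n)) (g : (T.induce X).typePreserving) (b : B)
    (i : Fin n) : L.glue f g (L.leaf b i) = L.leaf (L.move g b) (f (L.move g b) i) := by
  change L.e (Equiv.sumCongr g.1.toEquiv (L.leafEquiv f g) (L.e.symm (L.e (Sum.inr (b, i))))) = _
  rw [Equiv.symm_apply_apply]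
  rfl

theorem aut_ext {h k : T ≃g T} (hX : ∀ x : X, h x = k x)
    (hl : ∀ b i, h (L.leaf b i) = k (L.leaf b i)) : h = k := by
  ext v
  by_cases hv : v ∈ X
  · exact hX ⟨v, hv⟩
  · obtain ⟨b, i, rfl⟩ := L.exists_leaf hv
    exact hl b i

theorem res_glue (f : B → Equiv.Perm (Fin n)) (g : (T.induce X).typePreserving) :
    L.res (L.glue f g) = g := by
  ext x
  rw [L.res_apply, L.glue_apply]

/-- As `X` is invariant, leaves go to leaves, and the only neighbor of a leaf tells at which vertex
it hangs. -/
theorem exists_perm (h : T ≃g T) (b : B) :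
    ∃ σ : Equiv.Perm (Fin n), ∀ i, h (L.leaf b i) = L.leaf (L.move (L.res h) b) (σ i) := by
  have hex : ∀ i, ∃ j, h (L.leaf b i) = L.leaf (L.move (L.res h) b) j := fun i => by
    have hn : h (L.leaf b i) ∉ X := fun hm => L.leaf_notMem b i
      (by simpa using L.map_mem h⁻¹ _ hm)
    obtain ⟨c, j, hc⟩ := L.exists_leaf hn
    have hadj : T.Adj (L.leaf c j) (h b.1) := hc ▸ h.map_rel_iff.2 ((L.leaf_adj b i).2 rfl)
    have : L.move (L.res h) b = c := Subtype.ext (Subtype.ext ((L.leaf_adj c j).1 hadj))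
    exact ⟨j, by rw [hc, this]⟩
  choose σ hσ using hex
  have hinj : Function.Injective σ := fun i j hij =>
    (L.leaf_inj.1 (h.injective ((hσ i).trans (hij ▸ (hσ j).symm)))).2
  exact ⟨Equiv.ofBijective σ (Finite.injective_iff_bijective.1 hinj), hσ⟩

/-- The permutation of `Fin n` that `h` induces from the leaves at `b` to the leaves at `h b`. -/
noncomputable def perm (h : T ≃g T) (b : B) : Equiv.Perm (Fin n) := (L.exists_perm h b).choose

theorem apply_leaf (h : T ≃g T) (b : B) (i : Fin n) :
    h (L.leaf b i) = L.leaf (L.move (L.res h) b) (L.perm h b i) :=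
  (L.exists_perm h b).choose_spec i

theorem perm_eq {h : T ≃g T} {b c : B} {σ : Equiv.Perm (Fin n)}
    (hσ : ∀ i, h (L.leaf b i) = L.leaf c (σ i)) : L.perm h b = σ := by
  ext i
  have := hσ i
  rw [L.apply_leaf, L.leaf_inj] at this
  rw [this.2]

theorem perm_one (b : B) : L.perm 1 b = 1 := L.perm_eq (c := b) fun _ => rfl

theorem perm_mul (h k : T ≃g T) (b : B) :
    L.perm (h * k) b = L.perm h (L.move (L.res k) b) * L.perm k b :=
  L.perm_eq (c := L.move (L.res h) (L.move (L.res k) b)) fun i => by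
    rw [RelIso.mul_apply, L.apply_leaf, L.apply_leaf]
    rfl

theorem perm_glue (f : B → Equiv.Perm (Fin n)) (g : (T.induce X).typePreserving) (b : B) :
    L.perm (L.glue f g) b = f (L.move g b) :=
  L.perm_eq fun i => L.glue_leaf f g b i

/-- In `glue` a coordinate is indexed by the vertex where the leaves arrive, in `perm` by the vertex
from which they depart; hence the inverse. -/
theorem glue_perm (h : T ≃g T) :
    L.glue (fun b => L.perm h (L.move (L.res h)⁻¹ b)) (L.res h) = h := by
  refine L.aut_ext (fun x => ?_) fun b i => ?_
  · rw [L.glue_apply, L.res_apply]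
  · rw [L.glue_leaf, L.apply_leaf, L.move_inv_move]

theorem isOpen_perm_eq (b : B) (σ : Equiv.Perm (Fin n)) : IsOpen {h : T ≃g T | L.perm h b = σ} := by
  classical
  rw [isOpen_aut_iff]
  rintro h rfl
  refine ⟨Finset.univ.image (L.leaf b), fun k hk => ?_⟩
  refine L.perm_eq (c := L.move (L.res h) b) fun i => ?_
  rw [hk _ (Finset.mem_image_of_mem _ (Finset.mem_univ i)), L.apply_leaf]

/-- The closed group of the automorphisms of `T` that induce even permutations of the leaves. -/
noncomputable def evenSubgroup : ClosedSubgroup (T ≃g T) where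
  carrier := {h | ∀ b, L.perm h b ∈ alternatingGroup (Fin n)}
  mul_mem' {h k} hh hk b := by
    rw [L.perm_mul]
    exact mul_mem (hh _) (hk _)
  one_mem' b := by
    rw [L.perm_one]
    exact one_mem _
  inv_mem' {h} hh b := by
    have h1 := L.perm_mul h h⁻¹ b
    rw [mul_inv_cancel, L.perm_one] at h1
    rw [← inv_eq_of_mul_eq_one_right h1.symm]
    exact inv_mem (hh _)
  isClosed' := by
    have : {h : T ≃g T | ∀ b, L.perm h b ∈ alternatingGroup (Fin n)} =
        ⋂ b, ⋃ σ ∈ (alternatingGroup (Fin n) : Set (Equiv.Perm (Fin n))),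
          {h : T ≃g T | L.perm h b = σ} := by
      ext h
      simp
    change IsClosed {h : T ≃g T | ∀ b, L.perm h b ∈ alternatingGroup (Fin n)}
    rw [this]
    refine isClosed_iInter fun b => (Set.toFinite _).isClosed_biUnion fun σ _ => ⟨?_⟩
    have : {h : T ≃g T | L.perm h b = σ}ᶜ = ⋃ τ ∈ {τ | τ ≠ σ}, {h : T ≃g T | L.perm h b = τ} := by
      ext h
      simp
    rw [this]
    exact isOpen_biUnion fun τ _ => L.isOpen_perm_eq b τ

theorem glue_mem (f : B → alternatingGroup (Fin n)) (g : (T.induce X).typePreserving) :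
    L.glue (fun b => f b) g ∈ L.evenSubgroup.toSubgroup := fun b => by
  rw [L.perm_glue]
  exact (f _).2

/-- The group of the automorphisms of `T` that induce even permutations of the leaves is a
semidirect product. -/
noncomputable def evenMulEquiv :
    (B → alternatingGroup (Fin n))
      ⋊[(T.induce X).permuteCoordinates L.invariant (alternatingGroup (Fin n))]
      (T.induce X).typePreserving ≃* L.evenSubgroup.toSubgroup where
  toFun s := ⟨L.glue (fun b => s.left b) s.right, L.glue_mem _ _⟩
  invFun h := ⟨fun b => ⟨L.perm h.1 (L.move (L.res h.1)⁻¹ b), h.2 _⟩, L.res h.1⟩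
  left_inv s := by
    refine SemidirectProduct.ext ?_ (L.res_glue _ _)
    funext b
    refine Subtype.ext ?_
    change L.perm (L.glue (fun b => s.left b) s.right) _ = _
    rw [L.perm_glue, L.res_glue, L.move_move_inv]
  right_inv h := Subtype.ext (L.glue_perm h.1)
  map_mul' s t := by
    refine Subtype.ext (L.aut_ext (fun x => ?_) fun b i => ?_)
    · change L.glue _ _ _ = L.glue _ _ (L.glue _ _ _)
      rw [L.glue_apply, L.glue_apply, L.glue_apply]
      rfl
    · change L.glue _ _ _ = L.glue _ _ (L.glue _ _ _)
      rw [L.glue_leaf, L.glue_leaf, L.glue_leaf]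
      simp only [SemidirectProduct.mul_right, SemidirectProduct.mul_left, L.move_mul, Pi.mul_apply,
        permuteCoordinates_apply]
      rw [show moveIn L.invariant s.right⁻¹ (L.move s.right (L.move t.right b)) =
        L.move t.right b from L.move_inv_move _ _]
      rfl

end LeafData

end SimpleGraph

/-! ### Topology of the semidirect product and its open normal subgroups -/

namespace SimpleGraph

theorem continuous_semidirectProduct_left {N : Type u} {Q : Type v} [Group N] [Group Q]
    [TopologicalSpace N] [TopologicalSpace Q] (φ : Q →* MulAut N) :
    Continuous (fun x : N ⋊[φ] Q => x.left) :=
  continuous_fst.comp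
    (continuous_induced_dom : Continuous fun x : N ⋊[φ] Q => (x.left, x.right))

theorem continuous_semidirectProduct_right {N : Type u} {Q : Type v} [Group N] [Group Q]
    [TopologicalSpace N] [TopologicalSpace Q] (φ : Q →* MulAut N) :
    Continuous (fun x : N ⋊[φ] Q => x.right) :=
  continuous_snd.comp
    (continuous_induced_dom : Continuous fun x : N ⋊[φ] Q => (x.left, x.right))

theorem continuous_semidirectProduct_inl {N : Type u} {Q : Type v} [Group N] [Group Q]
    [TopologicalSpace N] [TopologicalSpace Q] (φ : Q →* MulAut N) :
    Continuous (SemidirectProduct.inl : N → N ⋊[φ] Q) :=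
  continuous_induced_rng.2 (continuous_id.prodMk continuous_const)

theorem continuous_semidirectProduct_inr {N : Type u} {Q : Type v} [Group N] [Group Q]
    [TopologicalSpace N] [TopologicalSpace Q] (φ : Q →* MulAut N) :
    Continuous (SemidirectProduct.inr : Q → N ⋊[φ] Q) :=
  continuous_induced_rng.2 (continuous_const.prodMk continuous_id)

instance alternatingGroupDiscrete (n : ℕ) : DiscreteTopology (alternatingGroup (Fin n)) := ⟨rfl⟩

namespace LeafData

variable {V : Type u} {T : SimpleGraph V} {X : Set V} {B : Set X} {n : ℕ} (L : T.LeafData X B n)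

/-- The image of a leaf at `b` depends only on the image `c` of `b` and on the coordinate at `c`, so
the condition is a union over `c` of open conditions. -/
theorem continuous_evenMulEquiv : Continuous L.evenMulEquiv := by
  refine Continuous.subtype_mk (continuous_aut_iff.2 fun x y => ?_) _
  have hr := continuous_semidirectProduct_right
    ((T.induce X).permuteCoordinates L.invariant (alternatingGroup (Fin n)))
  have hl := continuous_semidirectProduct_left
    ((T.induce X).permuteCoordinates L.invariant (alternatingGroup (Fin n)))
  by_cases hx : x ∈ X
  · simp only [show ∀ f g, L.glue f g x = (g.1 ⟨x, hx⟩ : V) from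
      fun f g => L.glue_apply f g ⟨x, hx⟩]
    by_cases hy : y ∈ X
    · convert! (isOpen_apply_eq (⟨x, hx⟩ : X) ⟨y, hy⟩).preimage
        (continuous_subtype_val.comp hr) using 1
      ext s
      simp [Subtype.ext_iff]
    · convert! isOpen_empty
      ext s
      simp only [Set.mem_ofPred_eq, Set.mem_empty_iff_false, iff_false]
      rintro rfl
      exact hy (Subtype.coe_prop _)
  · obtain ⟨b, i, rfl⟩ := L.exists_leaf hx
    simp only [L.glue_leaf]
    have hu : ∀ c : B, IsOpen ({s : (B → alternatingGroup (Fin n))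
          ⋊[(T.induce X).permuteCoordinates L.invariant (alternatingGroup (Fin n))]
          (T.induce X).typePreserving | s.right.1 b.1 = c.1} ∩
        {s | L.leaf c ((s.left c : Equiv.Perm (Fin n)) i) = y}) := fun c =>
      ((isOpen_apply_eq b.1 c.1).preimage (continuous_subtype_val.comp hr)).inter
        ((isOpen_discrete {a : alternatingGroup (Fin n) | L.leaf c (a.1 i) = y}).preimage
          ((continuous_apply c).comp hl))
    convert! isOpen_iUnion hu using 1
    ext s
    simp only [Set.mem_ofPred_eq, Set.mem_iUnion, Set.mem_inter_iff]
    constructor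
    · exact fun h => ⟨L.move s.right b, rfl, h⟩
    · rintro ⟨c, hc, h⟩
      rwa [show L.move s.right b = c from Subtype.ext hc]

theorem continuous_res : Continuous L.res :=
  Continuous.subtype_mk (continuous_aut_iff.2 fun x y => by
    convert! isOpen_apply_eq (G := T) x.1 y.1 using 1
    ext h
    exact Subtype.ext_iff) _

theorem continuous_evenMulEquiv_symm : Continuous L.evenMulEquiv.symm := by
  refine continuous_induced_rng.2 (Continuous.prodMk (continuous_pi fun b => ?_)
    (L.continuous_res.comp continuous_subtype_val))
  rw [continuous_discrete_rng]
  intro a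
  have hu : ∀ c : B, IsOpen ({h : L.evenSubgroup.toSubgroup | h.1 c.1 = b.1} ∩
      {h | L.perm h.1 c = a.1}) := fun c =>
    ((isOpen_apply_eq c.1.1 b.1.1).preimage continuous_subtype_val).inter
      ((L.isOpen_perm_eq c a.1).preimage continuous_subtype_val)
  convert! isOpen_iUnion hu using 1
  ext h
  change (⟨L.perm h.1 (L.move (L.res h.1)⁻¹ b), _⟩ : alternatingGroup (Fin n)) = a ↔ _
  simp only [Set.mem_iUnion, Set.mem_inter_iff, Set.mem_ofPred_eq, Subtype.ext_iff]
  constructor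
  · intro ha
    exact ⟨_, by rw [← L.move_apply, L.move_move_inv], ha⟩
  · rintro ⟨c, hc, ha⟩
    rwa [L.move_inv_eq.2 (show L.move (L.res h.1) c = b from Subtype.ext (Subtype.ext hc))]

/-- The semidirect product decomposition of the group of automorphisms of `T` that induce even
permutations of the leaves is a homeomorphism. -/
noncomputable def evenContinuousMulEquiv :
    L.evenSubgroup.toSubgroup ≃ₜ* (B → alternatingGroup (Fin n))
      ⋊[(T.induce X).permuteCoordinates L.invariant (alternatingGroup (Fin n))]
      (T.induce X).typePreserving :=
  { L.evenMulEquiv.symm with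
    continuous_toFun := L.continuous_evenMulEquiv_symm
    continuous_invFun := L.continuous_evenMulEquiv }

end LeafData

/-- The normal core of an open subgroup of finite index is closed of finite index, hence open, so it
suffices to treat normal subgroups. -/
theorem openFiniteResidual_eq_top {H : Type u} [Group H] [TopologicalSpace H] [IsTopologicalGroup H]
    (h : ∀ P : Subgroup H, P.Normal → IsOpen (P : Set H) → P = ⊤) :
    openFiniteResidual H = ⊤ := by
  rw [openFiniteResidual, sInf_eq_top]
  rintro P ⟨hP, hfin⟩
  have hcore : IsOpen (P.normalCore : Set H) :=
    Subgroup.isOpen_of_isClosed_of_finiteIndex _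
      (P.normalCore_isClosed (Subgroup.isClosed_of_isOpen P hP))
  rw [eq_top_iff, ← h _ inferInstance hcore]
  exact P.normalCore_le

/-- A semidirect product of the cubic tree group with a power of a discrete group, indexed by an
invariant set of vertices, has no proper open normal subgroup. -/
theorem Tricoloring.semidirectProduct_normal_open_eq_top {W : Type u} {Γ : SimpleGraph W}
    (S : Γ.Tricoloring) (hΓ : Γ.IsTree) (c : Γ.Coloring Bool) {B : Set W}
    (hB : Γ.IsTypeInvariant B) {A : Type v} [Group A] [TopologicalSpace A]
    (P : Subgroup ((B → A) ⋊[Γ.permuteCoordinates hB A] Γ.typePreserving)) [hPn : P.Normal]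
    (hP : IsOpen (P : Set ((B → A) ⋊[Γ.permuteCoordinates hB A] Γ.typePreserving))) : P = ⊤ := by
  classical
  have hinr : P.comap SemidirectProduct.inr = ⊤ :=
    S.normal_open_eq_top hΓ c (hP.preimage (continuous_semidirectProduct_inr _))
  obtain ⟨F, U, hU, hF⟩ := isOpen_pi_iff.1
    (hP.preimage (continuous_semidirectProduct_inl _)) 1 (by simp [P.one_mem])
  have hF' : ∀ f : B → A, (∀ b ∈ F, f b = 1) → SemidirectProduct.inl f ∈ P := fun f hf =>
    hF (fun b hb => by rw [hf b hb]; exact (hU b hb).2)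
  obtain ⟨k, hk, hkF⟩ := S.exists_map_finset_disjoint hΓ c (F.image Subtype.val)
  have hinl : ∀ f : B → A, SemidirectProduct.inl f ∈ P := by
    intro f
    let f₁ : B → A := fun b => if b ∈ F then f b else 1
    let f₂ : B → A := fun b => if b ∈ F then 1 else f b
    have hf : f = f₁ * f₂ := by
      funext b
      by_cases hb : b ∈ F <;> simp [f₁, f₂, hb]
    have h₂ : SemidirectProduct.inl f₂ ∈ P := hF' _ fun b hb => by simp [f₂, hb]
    -- The translate of `f₁` by `k⁻¹` is supported on the preimage of `F` under `k`, which is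
    -- disjoint from `F`.
    have h₁ : SemidirectProduct.inl (Γ.permuteCoordinates hB A ⟨k, hk⟩⁻¹ f₁) ∈ P := by
      refine hF' _ fun b hb => ?_
      rw [permuteCoordinates_apply, inv_inv]
      refine if_neg fun hm => ?_
      exact hkF b (Finset.mem_image_of_mem _ hb) (Finset.mem_image_of_mem Subtype.val hm)
    rw [SemidirectProduct.inl_aut] at h₁
    have h₁' := hPn.conj_mem _ h₁ (SemidirectProduct.inr ⟨k, hk⟩)
    rw [hf, map_mul]
    refine P.mul_mem ?_ h₂
    simpa [mul_assoc, ← map_mul] using h₁'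
  rw [eq_top_iff]
  intro s _
  rw [← SemidirectProduct.inl_left_mul_inr_right s]
  exact P.mul_mem (hinl _) (show s.right ∈ P.comap SemidirectProduct.inr from hinr ▸ trivial)

theorem LeafData.openFiniteResidual_evenSubgroup {V : Type u} {T : SimpleGraph V} {X : Set V}
    {B : Set X} {n : ℕ} (L : T.LeafData X B n) (S : (T.induce X).Tricoloring)
    (hX : (T.induce X).IsTree) (c : (T.induce X).Coloring Bool) :
    openFiniteResidual L.evenSubgroup.toSubgroup = ⊤ := by
  refine openFiniteResidual_eq_top fun P hP hPo => ?_
  have hn : (P.comap L.evenMulEquiv.toMonoidHom).Normal := inferInstance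
  have h := S.semidirectProduct_normal_open_eq_top hX c L.invariant
    (P.comap L.evenMulEquiv.toMonoidHom) (hPo.preimage L.continuous_evenMulEquiv)
  rw [eq_top_iff]
  intro x _
  have : L.evenMulEquiv.symm x ∈ P.comap L.evenMulEquiv.toMonoidHom := h ▸ trivial
  simpa using this

end SimpleGraph

/-! ### Chabauty limits and the failure of simplicity -/

theorem isOpen_chabauty_inter_nonempty {G : Type u} [Group G] [TopologicalSpace G]
    [IsTopologicalGroup G] {U : Set G} (hU : IsOpen U) :
    IsOpen {J : ClosedSubgroup G | ((J.toSubgroup : Set G) ∩ U).Nonempty} := by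
  rintro H ⟨h, hH, hhU⟩
  -- For the compact set `{h}`, closeness gives `h = j * w` with `j` in `J`; the neighborhood is
  -- chosen so that `j = h * w⁻¹` lies in `U`.
  refine ⟨{h}, (fun w => h * w⁻¹) ⁻¹' U, isCompact_singleton,
    hU.preimage (continuous_const.mul continuous_inv), by simpa using hhU, ?_⟩
  rintro J ⟨-, hJ⟩
  obtain ⟨j, hj, w, hw, hjw⟩ := Set.mem_mul.1 (hJ ⟨hH, rfl⟩)
  refine ⟨j, hj, ?_⟩
  have : h * w⁻¹ = j := by rw [← hjw, mul_inv_cancel_right]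
  rw [← this]
  exact hw

namespace SimpleGraph

theorem exists_aut_limit {V : Type u} {T : SimpleGraph V} {ι : Type*} {l : Filter ι} [l.NeBot]
    {g : ι → (T ≃g T)} (hg : ∀ x, ∃ y, ∀ᶠ n in l, g n x = y)
    (hg' : ∀ x, ∃ y, ∀ᶠ n in l, (g n)⁻¹ x = y) :
    ∃ k : T ≃g T, ∀ x, ∀ᶠ n in l, g n x = k x := by
  choose f hf using hg
  choose f' hf' using hg'
  have hl : ∀ x, f' (f x) = x := fun x => by
    obtain ⟨n, h1, h2⟩ := ((hf x).and (hf' (f x))).exists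
    rw [← h2, ← h1, RelIso.inv_apply_self]
  have hr : ∀ x, f (f' x) = x := fun x => by
    obtain ⟨n, h1, h2⟩ := ((hf' x).and (hf (f' x))).exists
    rw [← h2, ← h1, RelIso.apply_inv_self]
  refine ⟨⟨⟨f, f', hl, hr⟩, fun {x y} => ?_⟩, hf⟩
  obtain ⟨n, h1, h2⟩ := ((hf x).and (hf y)).exists
  change T.Adj (f x) (f y) ↔ _
  rw [← h1, ← h2]
  exact (g n).map_rel_iff

theorem mem_of_aut_limit {V : Type u} {T : SimpleGraph V} {ι : Type*} {l : Filter ι} [l.NeBot]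
    {g : ι → (T ≃g T)} {k : T ≃g T} (hk : ∀ x, ∀ᶠ n in l, g n x = k x) {J : Set (T ≃g T)}
    (hJ : IsClosed J) (hgJ : ∀ n, g n ∈ J) : k ∈ J := by
  rw [← hJ.closure_eq, mem_closure_iff_nhds]
  intro U hU
  obtain ⟨F, hF⟩ := mem_nhds_aut.1 hU
  obtain ⟨n, hn⟩ := ((Filter.eventually_all_finset F).2 fun x _ => hk x).exists
  exact ⟨g n, hF _ hn, hgJ n⟩

theorem Tricoloring.pow_apply {W : Type u} {Γ : SimpleGraph W} (S : Γ.Tricoloring)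
    {g : Γ ≃g Γ} {a : W} {σ : Equiv.Perm (Fin 3)} (hσ : ∀ i, g (S.s i a) = S.s (σ i) a)
    (m : ℕ) (i : Fin 3) : (g ^ m) (S.s i a) = S.s ((σ ^ m) i) a := by
  induction m with
  | zero => rfl
  | succ m ih => rw [pow_succ', RelIso.mul_apply, ih, hσ, pow_succ', Equiv.Perm.mul_apply]

/-- The order of `Sym(3)` is 6: if a power of `g` fixes a vertex, its sixth power also fixes the
neighbors. Each further sixth power enlarges the fixed ball by one. -/
theorem Tricoloring.pow_six_pow_apply {W : Type u} {Γ : SimpleGraph W} (S : Γ.Tricoloring)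
    (hΓ : Γ.Connected) {g : Γ ≃g Γ} {a : W} (ha : g a = a) (n : ℕ) {x : W}
    (hx : Γ.dist a x ≤ n) : (g ^ 6 ^ n) x = x := by
  induction n generalizing x with
  | zero =>
    obtain rfl : a = x := hΓ.dist_eq_zero_iff.1 (by lia)
    simpa using ha
  | succ n ih =>
    have hstep : ∀ y, (g ^ 6 ^ n) y = y → (g ^ 6 ^ (n + 1)) y = y ∧
        ∀ i, (g ^ 6 ^ (n + 1)) (S.s i y) = S.s i y := fun y hy => by
      obtain ⟨σ, hσ⟩ := S.exists_perm hy
      have h6 : σ ^ 6 = 1 := by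
        simpa [Fintype.card_perm, Nat.factorial] using pow_card_eq_one (x := σ)
      rw [pow_succ, pow_mul]
      refine ⟨?_, fun i => by rw [S.pow_apply hσ, h6]; rfl⟩
      generalize g ^ 6 ^ n = k at hy
      simp [pow_succ, RelIso.mul_apply, hy]
    rcases Nat.lt_or_ge (Γ.dist a x) (n + 1) with h | h
    · exact (hstep x (ih (by lia))).1
    · obtain ⟨p, hp⟩ := hΓ.exists_walk_length_eq_dist x a
      cases p with
      | nil => simp at h
      | @cons _ y _ hadj p =>
        have hd : Γ.dist a y ≤ n := by
          rw [dist_comm]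
          refine (dist_le p).trans ?_
          rw [Walk.length_cons, dist_comm] at hp
          lia
        obtain ⟨i, rfl⟩ := (S.adj_iff _ _).1 hadj.symm
        exact (hstep y (ih hd)).2 i

namespace LeafData

variable {V : Type u} {T : SimpleGraph V} {X : Set V} {B : Set X} {n : ℕ} (L : T.LeafData X B n)

/-- A leaf at an eventually fixed vertex has only `n` possible images, and an ultrafilter selects
one. This replaces a compactness argument. -/
theorem exists_eventually_eq (L : T.LeafData X B n) {l : Ultrafilter ℕ} {k : ℕ → (T ≃g T)}
    (hk : ∀ x : X, ∀ᶠ m in l, k m x = x) (v : V) : ∃ y, ∀ᶠ m in l, k m v = y := by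
  by_cases hv : v ∈ X
  · exact ⟨v, hk ⟨v, hv⟩⟩
  · obtain ⟨b, i, rfl⟩ := L.exists_leaf hv
    have h : ∀ᶠ m in l, ∃ j ∈ (Set.univ : Set (Fin n)), k m (L.leaf b i) = L.leaf b j := by
      filter_upwards [hk b.1] with m hm
      refine ⟨L.perm (k m) b i, trivial, ?_⟩
      rw [L.apply_leaf, show L.move (L.res (k m)) b = b from Subtype.ext (Subtype.ext hm)]
    obtain ⟨j, -, hj⟩ := (Ultrafilter.eventually_exists_mem_iff Set.finite_univ).1 h
    exact ⟨_, hj⟩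

theorem perm_pow {h : T ≃g T} {b : B} (hb : h b.1 = b.1) (m : ℕ) :
    L.perm (h ^ m) b = L.perm h b ^ m := by
  induction m with
  | zero => exact L.perm_one b
  | succ m ih =>
    rw [pow_succ, L.perm_mul, show L.move (L.res h) b = b from Subtype.ext (Subtype.ext hb), ih,
      pow_succ]

/-- A topologically simple closed group of automorphisms that does not fix `b` contains no element
fixing `b` and acting on the leaves at `b` by a nontrivial permutation of order prime to `6`. -/
theorem not_isTopologicallySimple (S : (T.induce X).Tricoloring) (hX : (T.induce X).Connected)
    {J : ClosedSubgroup (T ≃g T)} {b : B} {j j' : T ≃g T} (hj : j ∈ J.toSubgroup)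
    (hj' : j' ∈ J.toSubgroup) (hjb : j b.1 = b.1) (hjb' : j' b.1 ≠ b.1)
    (h6 : L.perm j b ^ 6 = L.perm j b) (h1 : L.perm j b ≠ 1) :
    ¬ IsTopologicallySimple J.toSubgroup := by
  intro hsimple
  -- The kernel of the action of `J` on `X` is the closed normal subgroup that contradicts
  -- simplicity.
  let K : Subgroup J.toSubgroup := (L.res.comp J.toSubgroup.subtype).ker
  have hmem : ∀ h : J.toSubgroup, h ∈ K ↔ ∀ x : X, h.1 x = x := fun h => by
    rw [MonoidHom.mem_ker]
    constructor
    · intro hh x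
      have := congrArg (fun g => ((g.1 x : X) : V)) hh
      exact this
    · intro hh
      ext x
      exact hh x
  have hclosed : IsClosed (K : Set J.toSubgroup) := by
    have : (K : Set J.toSubgroup) = ⋂ x : X, Subtype.val ⁻¹' {h : T ≃g T | h x = x} := by
      ext h
      simpa using hmem h
    rw [this]
    exact isClosed_iInter fun x => (isClosed_apply_eq _ _).preimage continuous_subtype_val
  rcases hsimple K inferInstance hclosed with hK | hK
  · have hfix : ∀ x : X, ∀ᶠ m in (Filter.hyperfilter ℕ : Filter ℕ), (j ^ 6 ^ m) x = x := fun x => by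
      refine Nat.hyperfilter_le_atTop ?_
      filter_upwards [Filter.eventually_ge_atTop ((T.induce X).dist b.1 x)] with m hm
      have := S.pow_six_pow_apply hX (g := (L.res j).1) (Subtype.ext hjb) m hm
      have h2 : (L.res (j ^ 6 ^ m)).1 x = x := by
        rw [map_pow]
        exact this
      exact congrArg Subtype.val h2
    have hfix' : ∀ x : X, ∀ᶠ m in (Filter.hyperfilter ℕ : Filter ℕ), (j ^ 6 ^ m)⁻¹ x = x :=
      fun x => (hfix x).mono fun m hm => by
        conv_lhs => rw [← hm]
        rw [RelIso.inv_apply_self]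
    -- The limit of `j ^ 6 ^ m` along the ultrafilter is trivial on `X`, but acts on the leaves at
    -- `b` as `j` does.
    obtain ⟨k, hk⟩ := exists_aut_limit (L.exists_eventually_eq hfix)
      (L.exists_eventually_eq hfix')
    have hkJ : k ∈ (J.toSubgroup : Set (T ≃g T)) :=
      mem_of_aut_limit hk J.isClosed' fun m => pow_mem hj _
    have hkK : (⟨k, hkJ⟩ : J.toSubgroup) ∈ K := (hmem _).2 fun x => by
      obtain ⟨m, h3, h4⟩ := ((hfix x).and (hk x)).exists
      rw [← h4, h3]
    rw [hK, Subgroup.mem_bot] at hkK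
    have hk1 : k = 1 := congrArg Subtype.val hkK
    apply h1
    have hpow : ∀ m, L.perm j b ^ 6 ^ m = L.perm j b := fun m => by
      induction m with
      | zero => simp
      | succ m ih => rw [pow_succ, pow_mul, ih, h6]
    ext i
    obtain ⟨m, hm, hmb⟩ := ((hk (L.leaf b i)).and (hfix b.1)).exists
    rw [hk1, L.apply_leaf, L.perm_pow hjb, hpow] at hm
    exact congrArg Fin.val (L.leaf_inj.1 hm).2
  · have : (⟨j', hj'⟩ : J.toSubgroup) ∈ K := hK ▸ trivial
    exact hjb' ((hmem _).1 this b.1)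

/-- Having an element that fixes `b` and rotates its five leaves, and having one that moves `b`, are
Chabauty-open conditions. `H` satisfies both, since a 5-cycle is even, while a topologically simple
group cannot. -/
theorem evenSubgroup_notMem_closure (L : T.LeafData X B 5) (S : (T.induce X).Tricoloring)
    (hX : (T.induce X).IsTree) (c : (T.induce X).Coloring Bool) (b : B) :
    L.evenSubgroup ∉ closure {J : ClosedSubgroup (T ≃g T) | IsTopologicallySimple J.toSubgroup} := by
  intro hcl
  have hU : IsOpen ({h : T ≃g T | h b.1 = b.1} ∩ {h | L.perm h b = finRotate 5}) :=
    (isOpen_apply_eq _ _).inter (L.isOpen_perm_eq _ _)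
  have hU' : IsOpen {h : T ≃g T | h b.1 = b.1}ᶜ := (isClosed_apply_eq _ _).isOpen_compl
  have hf : finRotate 5 ∈ alternatingGroup (Fin 5) := by
    rw [Equiv.Perm.mem_alternatingGroup, sign_finRotate]
    rfl
  obtain ⟨k, hk, hkF⟩ := S.exists_map_finset_disjoint hX c {b.1}
  obtain ⟨J, ⟨⟨j, hj, hjb, hjp⟩, ⟨j', hj', hjb'⟩⟩, hJ⟩ := mem_closure_iff.1 hcl _
    ((isOpen_chabauty_inter_nonempty hU).inter (isOpen_chabauty_inter_nonempty hU'))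
    ⟨⟨L.glue (fun _ => finRotate 5) 1, L.glue_mem (fun _ => ⟨finRotate 5, hf⟩) 1,
      L.glue_apply _ _ _, L.perm_glue _ _ _⟩,
      ⟨L.glue (fun _ => 1) ⟨k, hk⟩, L.glue_mem (fun _ => 1) _, fun h => by
        have h2 : L.glue (fun _ => 1) ⟨k, hk⟩ b.1 = b.1 := h
        rw [L.glue_apply] at h2
        exact hkF b.1 (by simp) (by simpa using Subtype.ext h2)⟩⟩
  have hjp' : L.perm j b = finRotate 5 := hjp
  exact L.not_isTopologicallySimple S hX.connected hj hj' hjb hjb'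
    (by rw [hjp']; decide) (by rw [hjp']; decide) hJ

end LeafData

end SimpleGraph

/-! ### Coverings, neighbors and degrees -/

namespace SerreGraph.Covering

variable {V : Type u} {T : SimpleGraph V} {V' : Type v} {E' : Type w} {B : SerreGraph V' E'}
  (p : Covering T.toSerreGraph B)

theorem exists_next {x : V} {e : E'} (he : B.origin e = p.onVertices x) :
    ∃ y, ∃ h : T.Adj x y, p.onEdges ⟨(x, y), h⟩ = e := by
  obtain ⟨⟨⟨x', y⟩, h⟩, hx, hd⟩ := (p.bijOn_star x).surjOn he
  obtain rfl : x' = x := hx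
  exact ⟨y, h, hd⟩

open Classical in
/-- The neighbor of `x` along the edge over `e`. -/
noncomputable def next (x : V) (e : E') : V :=
  if he : B.origin e = p.onVertices x then (p.exists_next he).choose else x

variable {p} {x y : V} {e e' : E'}

theorem next_spec (he : B.origin e = p.onVertices x) :
    ∃ h : T.Adj x (p.next x e), p.onEdges ⟨(x, p.next x e), h⟩ = e := by
  rw [next, dif_pos he]
  exact (p.exists_next he).choose_spec

theorem adj_next (he : B.origin e = p.onVertices x) : T.Adj x (p.next x e) := (next_spec he).1

theorem next_eq (h : T.Adj x y) : p.next x (p.onEdges ⟨(x, y), h⟩) = y := by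
  have he : B.origin (p.onEdges ⟨(x, y), h⟩) = p.onVertices x := p.map_origin _
  obtain ⟨h', hn⟩ := next_spec he
  have := (p.bijOn_star x).injOn (x₁ := ⟨(x, _), h'⟩) (x₂ := ⟨(x, y), h⟩) rfl rfl hn
  exact congrArg (fun d : T.Dart => d.snd) this

theorem onVertices_next (he : B.origin e = p.onVertices x) :
    p.onVertices (p.next x e) = B.terminus e := by
  obtain ⟨h, hn⟩ := next_spec he
  have := p.map_terminus ⟨(x, p.next x e), h⟩
  rw [hn] at this
  exact this.symm

theorem next_next (he : B.origin e = p.onVertices x) :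
    p.next (p.next x e) (B.rev e) = x := by
  obtain ⟨h, hn⟩ := next_spec he
  have h2 : p.onEdges ⟨(p.next x e, x), h.symm⟩ = B.rev (p.onEdges ⟨(x, p.next x e), h⟩) :=
    p.map_rev ⟨(x, p.next x e), h⟩
  rw [hn] at h2
  rw [← h2, next_eq]

theorem next_inj (he : B.origin e = p.onVertices x) (he' : B.origin e' = p.onVertices x)
    (h : p.next x e = p.next x e') : e = e' := by
  obtain ⟨h1, hn⟩ := next_spec he
  obtain ⟨h2, hn'⟩ := next_spec he'
  rw [← hn, ← hn']
  congr 2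
  exact Prod.ext rfl h

theorem adj_iff : T.Adj x y ↔ ∃ e, B.origin e = p.onVertices x ∧ p.next x e = y :=
  ⟨fun h => ⟨_, p.map_origin ⟨(x, y), h⟩, next_eq h⟩, by
    rintro ⟨e, he, rfl⟩
    exact adj_next he⟩

theorem encard_neighborSet (p : Covering T.toSerreGraph B) (x : V) :
    (T.neighborSet x).encard = {e | B.origin e = p.onVertices x}.encard := by
  have : T.neighborSet x = p.next x '' {e | B.origin e = p.onVertices x} := by
    ext y
    exact adj_iff
  rw [this]
  exact Set.InjOn.encard_image fun e he e' he' h => next_inj he he' h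

end SerreGraph.Covering

namespace SimpleGraph

theorem Tricoloring.verticesOfDegree_three {W : Type u} {Γ : SimpleGraph W} (S : Γ.Tricoloring) :
    Γ.verticesOfDegree 3 = Set.univ := by
  refine Set.eq_univ_of_forall fun x => ?_
  have : Γ.neighborSet x = Set.range (fun i => S.s i x) := by
    ext y
    exact S.adj_iff x y
  change (Γ.neighborSet x).encard = _
  rw [this, ← Set.image_univ, Set.InjOn.encard_image fun i _ j _ h => S.s_inj i j x h]
  simp

theorem encard_neighborSet_map {V : Type u} {T : SimpleGraph V} (h : T ≃g T) (x : V) :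
    (T.neighborSet (h x)).encard = (T.neighborSet x).encard :=
  (Set.encard_congr (h.mapNeighborSet x)).symm

/-- Used to see that a vertex of degree one is never interior to a path. -/
theorem Walk.IsPath.exists_adj_ne {V : Type u} {T : SimpleGraph V} {a b x : V} {q : T.Walk a b}
    (hq : q.IsPath) (hx : x ∈ q.support) (ha : x ≠ a) (hb : x ≠ b) :
    ∃ y z, y ≠ z ∧ T.Adj x y ∧ T.Adj x z := by
  induction q with
  | nil => exact absurd (by simpa using hx) ha
  | @cons a a' b h q ih =>
    by_cases hxa : x = a'
    · subst hxa
      cases q with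
      | nil => exact absurd rfl hb
      | @cons _ a'' _ h' q =>
        refine ⟨a, a'', ?_, h.symm, h'⟩
        rintro rfl
        rw [Walk.cons_isPath_iff] at hq
        exact hq.2 (by simp)
    · exact ih hq.of_cons (by simpa [ha] using hx) hxa hb

end SimpleGraph

theorem encard_baseGraph_star (k : Fin 7) :
    {e | baseGraph.origin e = k}.encard = if k = 0 then 8 else if k = 1 then 3 else 1 := by
  have h : {e | baseGraph.origin e = k} =
      ((Finset.univ.filter fun e => baseGraph.origin e = k : Finset (Fin 8 × Bool)) :
        Set (Fin 8 × Bool)) := by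
    ext e
    simp
  rw [h, Set.encard_coe_eq_coe_finsetCard]
  have : ∀ k, (Finset.univ.filter fun e => baseGraph.origin e = k).card =
      if k = 0 then 8 else if k = 1 then 3 else 1 := by decide
  rw [this]
  split_ifs <;> rfl

/-- The edge of the given color between the two vertices of degree at least three, with the given
orientation. -/
def baseGraphEdge (i : Fin 3) (b : Bool) : Fin 8 × Bool := (Fin.castLE (by decide) i, b)

/-- The edge from the vertex of degree eight to a leaf, with the given orientation. -/
def baseGraphLeafEdge (i : Fin 5) (b : Bool) : Fin 8 × Bool := (Fin.natAdd 3 i, b)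

/-! ### The subtree and the leaves of the universal cover -/

namespace UniversalCover

open SimpleGraph SerreGraph.Covering

variable {V : Type u} {T : SimpleGraph V} {p : SerreGraph.Covering T.toSerreGraph baseGraph}

theorem mem_verticesOfDegree_eight (p : SerreGraph.Covering T.toSerreGraph baseGraph) {x : V} :
    x ∈ T.verticesOfDegree 8 ↔ p.onVertices x = 0 := by
  change (T.neighborSet x).encard = _ ↔ _
  rw [p.encard_neighborSet, encard_baseGraph_star]
  split_ifs with h h' <;> simp [h]

theorem mem_verticesOfDegree_three (p : SerreGraph.Covering T.toSerreGraph baseGraph) {x : V} :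
    x ∈ T.verticesOfDegree 3 ↔ p.onVertices x = 1 := by
  change (T.neighborSet x).encard = _ ↔ _
  rw [p.encard_neighborSet, encard_baseGraph_star]
  split_ifs with h h' <;> simp [*]

theorem mem_verticesOfDegree_one (p : SerreGraph.Covering T.toSerreGraph baseGraph) {x : V} :
    x ∈ T.verticesOfDegree 1 ↔ p.onVertices x ≠ 0 ∧ p.onVertices x ≠ 1 := by
  change (T.neighborSet x).encard = _ ↔ _
  rw [p.encard_neighborSet, encard_baseGraph_star]
  split_ifs with h h' <;> simp [*]

theorem onVertices_map_eq_zero (p : SerreGraph.Covering T.toSerreGraph baseGraph) (h : T ≃g T)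
    (x : V) : p.onVertices (h x) = 0 ↔ p.onVertices x = 0 := by
  rw [← mem_verticesOfDegree_eight, ← mem_verticesOfDegree_eight]
  change _ = _ ↔ _ = _
  rw [encard_neighborSet_map]

theorem onVertices_map_eq_one (p : SerreGraph.Covering T.toSerreGraph baseGraph) (h : T ≃g T)
    (x : V) : p.onVertices (h x) = 1 ↔ p.onVertices x = 1 := by
  rw [← mem_verticesOfDegree_three, ← mem_verticesOfDegree_three]
  change _ = _ ↔ _ = _
  rw [encard_neighborSet_map]

theorem onVertices_eq_zero_iff_of_adj (p : SerreGraph.Covering T.toSerreGraph baseGraph) {x y : V}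
    (h : T.Adj x y) : p.onVertices x = 0 ↔ p.onVertices y ≠ 0 := by
  have h1 := p.map_origin ⟨(x, y), h⟩
  have h2 := p.map_terminus ⟨(x, y), h⟩
  change _ = p.onVertices x at h1
  change _ = p.onVertices y at h2
  rw [← h1, ← h2]
  exact (by decide : ∀ e, baseGraph.origin e = 0 ↔ baseGraph.terminus e ≠ 0) _

theorem eq_of_adj_leaf (p : SerreGraph.Covering T.toSerreGraph baseGraph) {x y z : V}
    (h0 : p.onVertices x ≠ 0) (h1 : p.onVertices x ≠ 1) (hy : T.Adj x y) (hz : T.Adj x z) :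
    y = z := by
  have h : x ∈ T.verticesOfDegree 1 := (mem_verticesOfDegree_one p).2 ⟨h0, h1⟩
  obtain ⟨a, ha⟩ := Set.encard_eq_one.1 (show (T.neighborSet x).encard = 1 from h)
  have hy' : y ∈ T.neighborSet x := hy
  have hz' : z ∈ T.neighborSet x := hz
  rw [ha] at hy' hz'
  exact hy'.trans hz'.symm

theorem exists_onVertices_eq_zero (hT : T.IsTree)
    (p : SerreGraph.Covering T.toSerreGraph baseGraph) : ∃ x, p.onVertices x = 0 := by
  obtain ⟨x⟩ := hT.connected.nonempty
  obtain ⟨e, he⟩ := (by decide : ∀ k, ∃ e, baseGraph.origin e = k) (p.onVertices x)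
  by_cases h : p.onVertices x = 0
  · exact ⟨x, h⟩
  · exact ⟨p.next x e, (onVertices_eq_zero_iff_of_adj p (adj_next he).symm).2 h⟩

theorem treeHull_eq (p : SerreGraph.Covering T.toSerreGraph baseGraph) :
    T.treeHull (T.verticesOfDegree 3) = T.verticesOfDegree 3 ∪ T.verticesOfDegree 8 := by
  ext x
  constructor
  · rintro ⟨a, ha, b, hb, q, hq, hx⟩
    by_contra hn
    have hn' := not_or.1 hn
    rw [mem_verticesOfDegree_three p, mem_verticesOfDegree_eight p] at hn'
    obtain ⟨y, z, hyz, hy, hz⟩ := hq.exists_adj_ne hx (fun h => hn'.1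
      (h ▸ (mem_verticesOfDegree_three p).1 ha)) (fun h => hn'.1
      (h ▸ (mem_verticesOfDegree_three p).1 hb))
    exact hyz (eq_of_adj_leaf p hn'.2 hn'.1 hy hz)
  · rintro (hx | hx)
    · exact ⟨x, hx, x, hx, Walk.nil, Walk.IsPath.nil, by simp⟩
    · rw [mem_verticesOfDegree_eight p] at hx
      have ho : ∀ i, baseGraph.origin (baseGraphEdge i false) = p.onVertices x := fun i => hx.symm
      have hv : ∀ i, p.next x (baseGraphEdge i false) ∈ T.verticesOfDegree 3 := fun i => by
        rw [mem_verticesOfDegree_three p, onVertices_next (ho i)]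
        revert i
        decide
      -- Two of the three parallel edges lift to a path through `x` with distinct ends of degree 3.
      have hne : p.next x (baseGraphEdge 0 false) ≠ p.next x (baseGraphEdge 1 false) := fun h =>
        absurd (next_inj (ho 0) (ho 1) h) (by decide)
      refine ⟨_, hv 0, _, hv 1, Walk.cons (adj_next (ho 0)).symm
        (Walk.cons (adj_next (ho 1)) Walk.nil), ?_, by simp⟩
      simp [Walk.cons_isPath_iff, hne, (adj_next (ho 0)).ne', (adj_next (ho 1)).ne]

theorem isTree_induce {X : Set V} (hX : ∀ x, x ∈ X ↔ p.onVertices x = 0 ∨ p.onVertices x = 1)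
    (hT : T.IsTree) : (T.induce X).IsTree := by
  obtain ⟨x₀, hx₀⟩ := exists_onVertices_eq_zero hT p
  have : Nonempty X := ⟨x₀, (hX x₀).2 (Or.inl hx₀)⟩
  refine ⟨⟨fun x y => ?_⟩, hT.isAcyclic.induce X⟩
  obtain ⟨q, hq⟩ := (hT.existsUnique_path x.1 y.1).exists
  refine ⟨q.induce X fun z hz => ?_⟩
  by_contra hn
  have hn' := not_or.1 (mt (hX z).2 hn)
  obtain ⟨a, b, hab, ha, hb⟩ := hq.exists_adj_ne hz (fun h => hn (h ▸ x.2)) fun h => hn (h ▸ y.2)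
  exact hab (eq_of_adj_leaf p hn'.1 hn'.2 ha hb)

/-- The edge of color `i` at the image of `x`. -/
noncomputable def colorEdge (p : SerreGraph.Covering T.toSerreGraph baseGraph) (i : Fin 3) (x : V) :
    Fin 8 × Bool :=
  -- The Boolean is the orientation: `false` leaves the vertex 0, `true` leaves the vertex 1.
  baseGraphEdge i (decide (p.onVertices x ≠ 0))

theorem origin_colorEdge (i : Fin 3) {x : V} (hx : p.onVertices x = 0 ∨ p.onVertices x = 1) :
    baseGraph.origin (colorEdge p i x) = p.onVertices x := by
  rcases hx with hx | hx <;> simp only [colorEdge, hx] <;> revert i <;> decide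

theorem onVertices_next_colorEdge (i : Fin 3) {x : V}
    (hx : p.onVertices x = 0 ∨ p.onVertices x = 1) :
    p.onVertices (p.next x (colorEdge p i x)) = if p.onVertices x = 0 then 1 else 0 := by
  rw [onVertices_next (origin_colorEdge i hx)]
  rcases hx with hx | hx <;> simp only [colorEdge, hx] <;> revert i <;> decide

theorem colorEdge_next (i : Fin 3) {x : V} (hx : p.onVertices x = 0 ∨ p.onVertices x = 1) :
    colorEdge p i (p.next x (colorEdge p i x)) = baseGraph.rev (colorEdge p i x) := by
  have h := onVertices_next_colorEdge i hx
  rw [colorEdge, h]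
  clear h
  rcases hx with hx | hx <;> simp only [colorEdge, hx] <;> revert i <;> decide

/-- The edge coloring of the subtree `X` given by the three parallel edges of the base graph. -/
noncomputable def tricoloring (p : SerreGraph.Covering T.toSerreGraph baseGraph) {X : Set V}
    (hX : ∀ x, x ∈ X ↔ p.onVertices x = 0 ∨ p.onVertices x = 1) : (T.induce X).Tricoloring where
  s i x := ⟨p.next x (colorEdge p i x), (hX _).2 (by
    rw [onVertices_next_colorEdge i ((hX _).1 x.2)]
    split_ifs <;> simp)⟩
  s_s i x := Subtype.ext (by
    change p.next (p.next x (colorEdge p i x)) (colorEdge p i (p.next x (colorEdge p i x))) = x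
    have hx := (hX _).1 x.2
    rw [colorEdge_next i hx, next_next (origin_colorEdge i hx)])
  s_inj i j x h := by
    have hx := (hX _).1 x.2
    have := next_inj (origin_colorEdge i hx) (origin_colorEdge j hx) (congrArg Subtype.val h)
    exact Fin.castLE_injective (by decide) (congrArg Prod.fst this)
  adj_iff x y := by
    have hx := (hX _).1 x.2
    constructor
    · intro h
      obtain ⟨e, he, hy⟩ := (adj_iff (p := p)).1 (show T.Adj x.1 y.1 from h)
      have hy1 := (hX _).1 y.2
      rw [← hy, onVertices_next he] at hy1
      have : ∃ i, e = colorEdge p i x := by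
        rcases hx with hx | hx <;> rw [hx] at he <;> simp only [colorEdge, hx] <;>
          clear hy <;> revert e <;> decide
      obtain ⟨i, rfl⟩ := this
      exact ⟨i, Subtype.ext hy⟩
    · rintro ⟨i, rfl⟩
      exact adj_next (origin_colorEdge i hx)

/-- The coloring of the vertices of `X` according to their degree in `T`. -/
noncomputable def typeColoring (p : SerreGraph.Covering T.toSerreGraph baseGraph) (X : Set V) :
    (T.induce X).Coloring Bool :=
  Coloring.mk (fun x => decide (p.onVertices x = 0)) fun {x y} h => by
    have := onVertices_eq_zero_iff_of_adj p (show T.Adj x.1 y.1 from h)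
    simp [this]

theorem typeColoring_apply (X : Set V) (x : X) :
    typeColoring p X x = decide (p.onVertices x = 0) := rfl

section Leaves

variable {X V₈ : Set V}

/-- The leaf of label `i` at a vertex of degree eight. -/
noncomputable def leafAt (p : SerreGraph.Covering T.toSerreGraph baseGraph) (x : V) (i : Fin 5) :
    V := p.next x (baseGraphLeafEdge i false)

theorem origin_leafEdge {x : V} (hx : p.onVertices x = 0) (i : Fin 5) :
    baseGraph.origin (baseGraphLeafEdge i false) = p.onVertices x := hx.symm

theorem onVertices_leafAt {x : V} (hx : p.onVertices x = 0) (i : Fin 5) :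
    p.onVertices (leafAt p x i) = baseGraph.terminus (baseGraphLeafEdge i false) :=
  onVertices_next (origin_leafEdge hx i)

theorem onVertices_leafAt_ne {x : V} (hx : p.onVertices x = 0) (i : Fin 5) :
    ¬ (p.onVertices (leafAt p x i) = 0 ∨ p.onVertices (leafAt p x i) = 1) := by
  rw [onVertices_leafAt hx]
  revert i
  decide

theorem adj_leafAt {x y : V} (hx : p.onVertices x = 0) (i : Fin 5) :
    T.Adj (leafAt p x i) y ↔ y = x := by
  have h := not_or.1 (onVertices_leafAt_ne hx i)
  have hadj : T.Adj (leafAt p x i) x := (adj_next (origin_leafEdge hx i)).symm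
  exact ⟨fun hy => eq_of_adj_leaf p h.1 h.2 hy hadj, fun hy => hy ▸ hadj⟩

theorem leafAt_inj {x y : V} (hx : p.onVertices x = 0) (hy : p.onVertices y = 0) {i j : Fin 5}
    (h : leafAt p x i = leafAt p y j) : x = y ∧ i = j := by
  refine ⟨(adj_leafAt hy j).1 (h ▸ (adj_leafAt hx i).2 rfl), ?_⟩
  have := congrArg p.onVertices h
  rw [onVertices_leafAt hx, onVertices_leafAt hy] at this
  clear h
  revert i j
  decide

theorem exists_leafAt {x : V} (hx : ¬ (p.onVertices x = 0 ∨ p.onVertices x = 1)) :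
    ∃ y i, p.onVertices y = 0 ∧ leafAt p y i = x := by
  have key : ∀ k : Fin 7, ¬ (k = 0 ∨ k = 1) →
      ∃ i : Fin 5, baseGraph.origin (baseGraphLeafEdge i true) = k := by decide
  obtain ⟨i, hi⟩ := key _ hx
  exact ⟨p.next x (baseGraphLeafEdge i true), i, onVertices_next hi, next_next hi⟩

/-- The vertices of `T` are the vertices of `X` and five leaves at each vertex of degree eight. -/
noncomputable def vertexEquiv (p : SerreGraph.Covering T.toSerreGraph baseGraph)
    (hX : ∀ x, x ∈ X ↔ p.onVertices x = 0 ∨ p.onVertices x = 1)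
    (h8 : ∀ x, x ∈ V₈ ↔ p.onVertices x = 0) : X ⊕ ({x : X | x.1 ∈ V₈} × Fin 5) ≃ V :=
  Equiv.ofBijective (Sum.elim Subtype.val fun q => leafAt p q.1.1.1 q.2) (by
    constructor
    · rintro (x | ⟨b, i⟩) (y | ⟨c, j⟩) h
      · exact congrArg _ (Subtype.ext h)
      · refine absurd ((hX _).1 x.2) ?_
        rw [show x.1 = leafAt p c.1.1 j from h]
        exact onVertices_leafAt_ne ((h8 _).1 c.2) j
      · refine absurd ((hX _).1 y.2) ?_
        rw [show y.1 = leafAt p b.1.1 i from h.symm]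
        exact onVertices_leafAt_ne ((h8 _).1 b.2) i
      · obtain ⟨h1, rfl⟩ := leafAt_inj ((h8 _).1 b.2) ((h8 _).1 c.2) h
        rw [show b = c from Subtype.ext (Subtype.ext h1)]
    · intro v
      by_cases hv : p.onVertices v = 0 ∨ p.onVertices v = 1
      · exact ⟨Sum.inl ⟨v, (hX v).2 hv⟩, rfl⟩
      · obtain ⟨y, i, hy, rfl⟩ := exists_leafAt hv
        exact ⟨Sum.inr (⟨⟨y, (hX y).2 (Or.inl hy)⟩, (h8 y).2 hy⟩, i), rfl⟩)

/-- A universal covering tree of the base graph consists of the subtree `X` and five leaves at each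
vertex of degree eight. -/
noncomputable def leafData (hT : T.IsTree) (p : SerreGraph.Covering T.toSerreGraph baseGraph)
    (hX : ∀ x, x ∈ X ↔ p.onVertices x = 0 ∨ p.onVertices x = 1)
    (h8 : ∀ x, x ∈ V₈ ↔ p.onVertices x = 0) : T.LeafData X {x : X | x.1 ∈ V₈} 5 where
  e := vertexEquiv p hX h8
  e_inl _ := rfl
  adj_leaf q v := adj_leafAt ((h8 _).1 q.1.2) q.2
  invariant g hg x hx := by
    have h := hg (typeColoring p X) x
    rw [typeColoring_apply, typeColoring_apply, decide_eq_decide] at h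
    exact (h8 _).2 (h.2 ((h8 _).1 hx))
  map_mem h x hx := by
    rw [hX, onVertices_map_eq_zero, onVertices_map_eq_one]
    exact (hX x).1 hx
  restrict_mem h := by
    have htree := isTree_induce hX hT
    obtain ⟨x⟩ := htree.connected.nonempty
    refine mem_typePreserving htree.connected (typeColoring p X) (x := x) ?_
    rw [typeColoring_apply, typeColoring_apply, decide_eq_decide]
    exact onVertices_map_eq_zero p h x

/-- The class of a vertex according to its degree. -/
noncomputable def degreeClass (p : SerreGraph.Covering T.toSerreGraph baseGraph) (x : V) : Fin 3 :=
  if p.onVertices x = 0 then 0 else if p.onVertices x = 1 then 1 else 2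

theorem degreeClass_map (h : T ≃g T) (x : V) : degreeClass p (h x) = degreeClass p x := by
  simp only [degreeClass, onVertices_map_eq_zero, onVertices_map_eq_one]

theorem degreeClass_surjective (hT : T.IsTree) : Function.Surjective (degreeClass p) := by
  obtain ⟨x, hx⟩ := exists_onVertices_eq_zero hT p
  intro k
  fin_cases k
  · exact ⟨x, by simp [degreeClass, hx]⟩
  · refine ⟨p.next x (colorEdge p 0 x), ?_⟩
    have := onVertices_next_colorEdge 0 (Or.inl hx)
    simp [degreeClass, this, hx]
  · refine ⟨leafAt p x 0, ?_⟩
    have := not_or.1 (onVertices_leafAt_ne hx 0)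
    simp [degreeClass, this]

/-- `Aut(X)⁺` is transitive on each type of vertex of `X`, and the powers of an even 5-cycle are
transitive on the labels of leaves. -/
theorem mem_orbit_of_degreeClass_eq (hT : T.IsTree)
    (p : SerreGraph.Covering T.toSerreGraph baseGraph)
    (hX : ∀ x, x ∈ X ↔ p.onVertices x = 0 ∨ p.onVertices x = 1)
    (h8 : ∀ x, x ∈ V₈ ↔ p.onVertices x = 0) {x y : V} (h : degreeClass p x = degreeClass p y) :
    ∃ g ∈ (leafData hT p hX h8).evenSubgroup.toSubgroup, g y = x := by
  set L := leafData hT p hX h8 with hL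
  have htree := isTree_induce hX hT
  have hcl : ∀ z : V, z ∈ X ↔ degreeClass p z ≠ 2 := fun z => by
    rw [hX, degreeClass]
    split_ifs <;> simp [*]
  by_cases hx : x ∈ X
  · have hy : y ∈ X := by rw [hcl, ← h, ← hcl]; exact hx
    have hc : typeColoring p X ⟨y, hy⟩ = typeColoring p X ⟨x, hx⟩ := by
      rw [typeColoring_apply, typeColoring_apply, decide_eq_decide]
      have h0 : ∀ z : V, p.onVertices z = 0 ↔ degreeClass p z = 0 := fun z => by
        rw [degreeClass]
        split_ifs <;> simp [*]
      rw [h0, h0, h]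
    obtain ⟨g, hg, hgy⟩ := (tricoloring p hX).exists_typePreserving htree _ hc
    exact ⟨L.glue (fun _ => 1) ⟨g, hg⟩, L.glue_mem (fun _ => 1) _,
      (L.glue_apply _ _ ⟨y, hy⟩).trans (congrArg Subtype.val hgy)⟩
  · have hy : y ∉ X := by rw [hcl, ← h, ← hcl]; exact hx
    obtain ⟨b, i, rfl⟩ := L.exists_leaf hx
    obtain ⟨c, j, rfl⟩ := L.exists_leaf hy
    have hc : typeColoring p X c.1 = typeColoring p X b.1 := by
      rw [typeColoring_apply, typeColoring_apply, (h8 _).1 c.2, (h8 _).1 b.2]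
    obtain ⟨g, hg, hgc⟩ := (tricoloring p hX).exists_typePreserving htree _ hc
    obtain ⟨k, hk⟩ := (by decide : ∀ i j : Fin 5, ∃ k : Fin 5, (finRotate 5 ^ k.1) j = i) i j
    have hf : finRotate 5 ^ k.1 ∈ alternatingGroup (Fin 5) := by
      refine pow_mem ?_ _
      rw [Equiv.Perm.mem_alternatingGroup, sign_finRotate]
      rfl
    refine ⟨L.glue (fun _ => finRotate 5 ^ k.1) ⟨g, hg⟩, L.glue_mem (fun _ => ⟨_, hf⟩) _, ?_⟩
    rw [L.glue_leaf, hk, show L.move ⟨g, hg⟩ c = b from Subtype.ext hgc]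

theorem vertexOrbitCount_evenSubgroup (hT : T.IsTree)
    (p : SerreGraph.Covering T.toSerreGraph baseGraph)
    (hX : ∀ x, x ∈ X ↔ p.onVertices x = 0 ∨ p.onVertices x = 1)
    (h8 : ∀ x, x ∈ V₈ ↔ p.onVertices x = 0) :
    vertexOrbitCount (leafData hT p hX h8).evenSubgroup.toSubgroup = 3 := by
  let f : MulAction.orbitRel.Quotient (leafData hT p hX h8).evenSubgroup.toSubgroup V → Fin 3 :=
    Quotient.lift (degreeClass p) (by
      rintro x y ⟨g, rfl⟩
      exact degreeClass_map g.1 y)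
  have hf : Function.Bijective f := by
    constructor
    · intro a b
      induction a using Quotient.inductionOn
      induction b using Quotient.inductionOn
      intro h
      obtain ⟨g, hg, hgy⟩ := mem_orbit_of_degreeClass_eq hT p hX h8 h
      exact Quotient.sound ⟨⟨g, hg⟩, hgy⟩
    · intro k
      obtain ⟨x, hx⟩ := degreeClass_surjective (p := p) hT k
      exact ⟨Quotient.mk _ x, hx⟩
  rw [vertexOrbitCount, ENat.card_congr (Equiv.ofBijective f hf)]
  simp

end Leaves

end UniversalCover

/-! ### Existence of the universal covering tree -/

namespace SerreGraph

variable {V' : Type v} {E' : Type w} (B : SerreGraph V' E') (o : V')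

/-- The end of an edge path with origin `o`, the last edge of the path coming first. -/
def pathEnd : List E' → V'
  | [] => o
  | e :: _ => B.terminus e

/-- A list of edges is an edge path with origin `o` without backtracking, the last edge of the path
coming first. -/
def IsReducedPath : List E' → Prop
  | [] => True
  | e :: l => B.origin e = B.pathEnd o l ∧ (∀ f, l.head? = some f → e ≠ B.rev f) ∧ IsReducedPath l

/-- The tree of reduced edge paths with origin `o`. -/
def pathTree : SimpleGraph {l // B.IsReducedPath o l} where
  Adj l m := ∃ e, m.1 = e :: l.1 ∨ l.1 = e :: m.1
  symm := ⟨fun _ _ ⟨e, h⟩ => ⟨e, h.symm⟩⟩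
  loopless := ⟨fun l ⟨e, h⟩ => by
    have := congrArg List.length (h.elim id id)
    simp at this⟩

theorem pathTree_connected : (B.pathTree o).Connected := by
  have h : ∀ (l : List E') (hl : B.IsReducedPath o l),
      (B.pathTree o).Reachable ⟨[], trivial⟩ ⟨l, hl⟩ := by
    intro l
    induction l with
    | nil => exact fun _ => SimpleGraph.Reachable.refl _
    | cons e l ih =>
      intro hl
      exact (ih hl.2.2).trans (SimpleGraph.Adj.reachable ⟨e, Or.inl rfl⟩)
  have : Nonempty {l // B.IsReducedPath o l} := ⟨⟨[], trivial⟩⟩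
  exact ⟨fun l m => (h l.1 l.2).symm.trans (h m.1 m.2)⟩

/-- The paths that extend `m` form a set which can only be left through the edge from `m` to `l`,
and `l` is too short to lie in it. -/
theorem pathTree_isBridge {l m : {l // B.IsReducedPath o l}} {e : E'} (h : m.1 = e :: l.1) :
    (B.pathTree o).IsBridge s(l, m) := by
  rw [SimpleGraph.isBridge_iff]
  intro hr
  obtain ⟨q⟩ := hr.symm
  have key : ∀ u v (_ : ((B.pathTree o).deleteEdges {s(l, m)}).Walk u v),
      m.1 <:+ u.1 → m.1 <:+ v.1 := by
    intro u v q
    induction q with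
    | nil => exact id
    | @cons u u' v hadj q ih =>
      intro hu
      apply ih
      rw [SimpleGraph.deleteEdges_adj] at hadj
      obtain ⟨⟨f, hf | hf⟩, hne⟩ := hadj
      · rw [hf]
        exact hu.trans (List.suffix_cons _ _)
      · rw [hf, List.suffix_cons_iff] at hu
        refine hu.resolve_left fun hm => hne ?_
        have h1 : u = m := Subtype.ext (by rw [hm, hf])
        have h2 : u' = l := Subtype.ext (by
          rw [h] at hm
          exact (List.cons.inj hm).2.symm)
        rw [h1, h2]
        exact Sym2.eq_swap
  have := (key _ _ q List.suffix_rfl).length_le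
  rw [h] at this
  simp at this

theorem pathTree_isTree : (B.pathTree o).IsTree := by
  refine ⟨B.pathTree_connected o, SimpleGraph.isAcyclic_iff_forall_adj_isBridge.2 ?_⟩
  rintro l m ⟨e, h | h⟩
  · exact B.pathTree_isBridge o h
  · rw [Sym2.eq_swap]
    exact B.pathTree_isBridge o h

open Classical in
/-- The edge over which a dart of the tree of reduced paths lies. -/
noncomputable def pathTreeEdge (d : (B.pathTree o).Dart) : E' :=
  if d.snd.1 = d.adj.choose :: d.fst.1 then d.adj.choose else B.rev d.adj.choose

variable {B o}

theorem pathTreeEdge_of_snd {d : (B.pathTree o).Dart} {e : E'} (h : d.snd.1 = e :: d.fst.1) :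
    B.pathTreeEdge o d = e := by
  have hs := d.adj.choose_spec
  rcases hs with hs | hs
  · rw [pathTreeEdge, if_pos hs]
    exact (List.cons.inj (hs.symm.trans h)).1
  · have h1 := congrArg List.length h
    have h2 := congrArg List.length hs
    simp only [List.length_cons] at h1 h2
    lia

theorem pathTreeEdge_of_fst {d : (B.pathTree o).Dart} {e : E'} (h : d.fst.1 = e :: d.snd.1) :
    B.pathTreeEdge o d = B.rev e := by
  have hs := d.adj.choose_spec
  have hn : ∀ f, d.snd.1 ≠ f :: d.fst.1 := fun f hf => by
    have h1 := congrArg List.length h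
    have h2 := congrArg List.length hf
    simp only [List.length_cons] at h1 h2
    lia
  rw [pathTreeEdge, if_neg (hn _)]
  exact congrArg B.rev (List.cons.inj ((hs.resolve_left (hn _)).symm.trans h)).1

theorem isReducedPath_cons {l : {l // B.IsReducedPath o l}} {m : List E'} {e : E'}
    (h : l.1 = e :: m) :
    B.origin e = B.pathEnd o m ∧ (∀ f, m.head? = some f → e ≠ B.rev f) ∧ B.IsReducedPath o m := by
  have := l.2
  rwa [h] at this

theorem origin_pathTreeEdge (d : (B.pathTree o).Dart) :
    B.origin (B.pathTreeEdge o d) = B.pathEnd o d.fst.1 := by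
  obtain ⟨e, h | h⟩ := d.adj
  · rw [pathTreeEdge_of_snd h]
    exact (isReducedPath_cons h).1
  · rw [pathTreeEdge_of_fst h, B.origin_rev, h]
    rfl

theorem pathTreeEdge_symm (d : (B.pathTree o).Dart) :
    B.pathTreeEdge o d.symm = B.rev (B.pathTreeEdge o d) := by
  obtain ⟨e, h | h⟩ := d.adj
  · rw [pathTreeEdge_of_snd h, pathTreeEdge_of_fst (d := d.symm) h]
  · rw [pathTreeEdge_of_fst h, pathTreeEdge_of_snd (d := d.symm) h, B.rev_rev]

variable (B o)

/-- The projection of the tree of reduced paths is a covering. -/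
noncomputable def pathTreeCovering : Covering (B.pathTree o).toSerreGraph B where
  onVertices l := B.pathEnd o l.1
  onEdges := B.pathTreeEdge o
  map_origin := origin_pathTreeEdge
  map_terminus d := by
    have := origin_pathTreeEdge d.symm
    rwa [pathTreeEdge_symm, B.origin_rev] at this
  map_rev := pathTreeEdge_symm
  bijOn_star l := by
    refine ⟨?_, ?_, ?_⟩
    · rintro d rfl
      exact origin_pathTreeEdge d
    · rintro d hd d' hd' hdd
      have hfst : d.fst = d'.fst := Eq.trans (show d.fst = l from hd) (show d'.fst = l from hd').symm
      -- A step that lengthens the path and one that shortens it cannot lie over the same edge: the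
      -- longer path would backtrack.
      have hback : ∀ d d' : (B.pathTree o).Dart, d.fst = d'.fst →
          B.pathTreeEdge o d = B.pathTreeEdge o d' → ∀ e f, d.snd.1 = e :: d.fst.1 →
          d'.fst.1 = f :: d'.snd.1 → False := by
        intro d d' hfst hdd e f h h'
        rw [pathTreeEdge_of_snd h, pathTreeEdge_of_fst h'] at hdd
        refine (isReducedPath_cons h).2.1 f ?_ hdd
        rw [hfst, h']
        rfl
      refine SimpleGraph.Dart.ext _ _ (Prod.ext hfst (Subtype.ext ?_))
      obtain ⟨e, h | h⟩ := d.adj <;> obtain ⟨e', h' | h'⟩ := d'.adj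
      · rw [pathTreeEdge_of_snd h, pathTreeEdge_of_snd h'] at hdd
        rw [h, h', hdd, hfst]
      · exact (hback d d' hfst hdd e e' h h').elim
      · exact (hback d' d hfst.symm hdd.symm e' e h' h).elim
      · rw [hfst, h'] at h
        exact (List.cons.inj h).2.symm
    · intro e he
      -- An edge reversing the last edge of the path is lifted by deleting that last edge; any other
      -- edge is lifted by appending it.
      by_cases hb : ∃ f m, l.1 = f :: m ∧ e = B.rev f
      · obtain ⟨f, m, hl, rfl⟩ := hb
        let m' : {l // B.IsReducedPath o l} := ⟨m, (isReducedPath_cons hl).2.2⟩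
        exact ⟨⟨(l, m'), ⟨f, Or.inr hl⟩⟩, rfl, pathTreeEdge_of_fst hl⟩
      · have hr : B.IsReducedPath o (e :: l.1) := by
          refine ⟨he, fun f hf hef => hb ?_, l.2⟩
          obtain ⟨m, hm⟩ := List.head?_eq_some_iff.1 hf
          exact ⟨f, m, hm, hef⟩
        let m' : {l // B.IsReducedPath o l} := ⟨e :: l.1, hr⟩
        exact ⟨⟨(l, m'), ⟨e, Or.inl rfl⟩⟩, rfl, pathTreeEdge_of_snd rfl⟩

theorem isUniversalCoveringTree_pathTree : B.IsUniversalCoveringTree (B.pathTree o) :=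
  ⟨B.pathTree_isTree o, ⟨B.pathTreeCovering o⟩⟩

end SerreGraph

/-! ### Assembly of the main theorem -/

open UniversalCover in
theorem mainTheorem12 :
    (∃ (V : Type) (T : SimpleGraph V), baseGraph.IsUniversalCoveringTree T) ∧
    ∀ (V : Type u) (T : SimpleGraph V), baseGraph.IsUniversalCoveringTree T →
      ∀ (V₁ V₃ V₈ X : Set V), V₁ = T.verticesOfDegree 1 → V₃ = T.verticesOfDegree 3 →
        V₈ = T.verticesOfDegree 8 → X = T.treeHull V₃ →
      -- the vertices of `T`, and the shape of the subtree `X`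
      V₁ ∪ V₃ ∪ V₈ = Set.univ ∧
      X = V₃ ∪ V₈ ∧
      (T.induce X).IsTree ∧
      (T.induce X).verticesOfDegree 3 = Set.univ ∧
      (T.induce X).IsBipartiteWith {x | x.1 ∈ V₃} {x | x.1 ∈ V₈} ∧
      -- `Aut(X)⁺` permutes the set of vertices `V₈`
      ∃ hB : (T.induce X).IsTypeInvariant {x | x.1 ∈ V₈},
      ∃ H : ClosedSubgroup (T ≃g T),
        Nonempty (H.toSubgroup ≃ₜ*
          ({x : X | x.1 ∈ V₈} → alternatingGroup (Fin 5))
            ⋊[(T.induce X).permuteCoordinates hB (alternatingGroup (Fin 5))]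
          (T.induce X).typePreserving) ∧
        openFiniteResidual H.toSubgroup = ⊤ ∧
        H ∉ closure {J : ClosedSubgroup (T ≃g T) | IsTopologicallySimple J.toSubgroup} ∧
        -- consequently, the description of the closure known without leaves fails for `T`
        vertexOrbitCount H.toSubgroup = 3 ∧
        ∀ C : ℕ, 3 ≤ C →
          closure {J : ClosedSubgroup (T ≃g T) |
              vertexOrbitCount J.toSubgroup ≤ C ∧ IsTopologicallySimple J.toSubgroup} ≠
            {J : ClosedSubgroup (T ≃g T) |
              vertexOrbitCount J.toSubgroup ≤ C ∧ openFiniteResidual J.toSubgroup = ⊤} := by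
  refine ⟨⟨_, _, baseGraph.isUniversalCoveringTree_pathTree 0⟩, ?_⟩
  rintro V T ⟨hT, ⟨p⟩⟩ V₁ V₃ V₈ X hV₁ hV₃ hV₈ hX
  have h1 : ∀ x, x ∈ V₁ ↔ p.onVertices x ≠ 0 ∧ p.onVertices x ≠ 1 := fun x =>
    hV₁ ▸ mem_verticesOfDegree_one p
  have h3 : ∀ x, x ∈ V₃ ↔ p.onVertices x = 1 := fun x => hV₃ ▸ mem_verticesOfDegree_three p
  have h8 : ∀ x, x ∈ V₈ ↔ p.onVertices x = 0 := fun x => hV₈ ▸ mem_verticesOfDegree_eight p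
  have hXu : X = V₃ ∪ V₈ := by rw [hX, hV₃, hV₈, treeHull_eq p]
  have hmem : ∀ x, x ∈ X ↔ p.onVertices x = 0 ∨ p.onVertices x = 1 := fun x => by
    rw [hXu, Set.mem_union, h3, h8, or_comm]
  clear hX
  have htree := isTree_induce hmem hT
  have S := tricoloring p hmem
  obtain ⟨x₀, hx₀⟩ := exists_onVertices_eq_zero hT p
  let L := leafData hT p hmem h8
  have hcl := L.evenSubgroup_notMem_closure S htree (typeColoring p X)
    ⟨⟨x₀, (hmem x₀).2 (Or.inl hx₀)⟩, (h8 x₀).2 hx₀⟩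
  have horb := vertexOrbitCount_evenSubgroup hT p hmem h8
  have hres := L.openFiniteResidual_evenSubgroup S htree (typeColoring p X)
  refine ⟨?_, hXu, htree, S.verticesOfDegree_three, ⟨?_, ?_⟩, L.invariant, L.evenSubgroup,
    ⟨L.evenContinuousMulEquiv⟩, hres, hcl, horb, fun C hC heq => ?_⟩
  · refine Set.eq_univ_of_forall fun x => ?_
    rw [Set.mem_union, Set.mem_union, h1, h3, h8]
    tauto
  · refine Set.disjoint_left.2 fun x hx hx' => ?_
    have h := ((h3 _).1 hx).symm.trans ((h8 _).1 hx')
    exact absurd h (by decide)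
  · intro x y hxy
    have h := onVertices_eq_zero_iff_of_adj p (show T.Adj x.1 y.1 from hxy)
    have hx := (hmem _).1 x.2
    have hy := (hmem _).1 y.2
    change (x.1 ∈ V₃ ∧ y.1 ∈ V₈) ∨ (x.1 ∈ V₈ ∧ y.1 ∈ V₃)
    rw [h3, h8, h3, h8]
    tauto
  -- With three orbits and full residual, `H` lies in the right-hand set; equality would put it in
  -- the closure of the simple groups.
  · have hle : {J : ClosedSubgroup (T ≃g T) | vertexOrbitCount J.toSubgroup ≤ C ∧
        IsTopologicallySimple J.toSubgroup} ⊆ {J | IsTopologicallySimple J.toSubgroup} :=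
      fun J hJ => hJ.2
    refine hcl (closure_mono hle ?_)
    rw [heq]
    exact ⟨horb.trans_le (by exact_mod_cast hC), hres⟩
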